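/- Consider an $N$-player ($N\ge 2$) infinite-horizon discounted Markov game with state space $\mathcal S$ (a finite or infinite set; all distributions on it are discrete), non-empty finite action sets $\mathcal A_1,\dots,\mathcal A_N$ of common size $A$, joint action set $\mathcal A=\mathcal A_1\times\dots\times\mathcal A_N$, transition probabilities $\mathbb P(\cdot\mid s,a)$, rewards $r_i:\mathcal S\times\mathcal A\to[0,1]$, discount factor $\gamma\in[0,1)$ and initial state distribution $\rho$. A joint policy is $\pi=(\pi_1,\dots,\pi_N)$ with $\pi_i:\mathcal S\to\Delta(\mathcal A_i)$, the players drawing their actions independently; $\pi_{-i}$ denotes the policies of all players but $i$. Let $$V_i^\pi(s)=\mathbb E^\pi\Big[\sum_{t\ge0}\gamma^t r_i(s^{(t)},a^{(t)})\,\Big|\,s^{(0)}=s\Big],\qquad Q_i^\pi(s,a)=\mathbb E^\pi\Big[\sum_{t\ge0}\gamma^t r_i(s^{(t)},a^{(t)})\,\Big|\,s^{(0)}=s,\ a^{(0)}=a\Big],$$ $V_i^\pi(\mu)=\mathbb E_{s\sim\mu}[V_i^\pi(s)]$, and $\bar Q_i^\pi(s,a_i)=\sum_{a_{-i}}\pi_{-i}(a_{-i}\mid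 s)\,Q_i^\pi(s,a_i,a_{-i})$. Assume that the game is a Markov potential game: there is a function $\Phi^\pi(s)$ of the joint policy and the state with $$V_i^{\pi_i,\pi_{-i}}(s)-V_i^{\pi_i',\pi_{-i}}(s)=\Phi^{\pi_i,\pi_{-i}}(s)-\Phi^{\pi_i',\pi_{-i}}(s)$$ for all $i$, $s$, $\pi_i$, $\pi_i'$, $\pi_{-i}$. Let $\Phi^{\max}>0$ be any constant with $|\mathbb E_{s\sim\mu}[\Phi^\pi(s)-\Phi^{\pi'}(s)]|\le\Phi^{\max}$ for all joint policies $\pi,\pi'$ and all state distributions $\mu$. Let $d_\rho^\pi(s)=(1-\gamma)\sum_{t\ge0}\gamma^t\Pr^\pi(s^{(t)}=s\mid s^{(0)}\sim\rho)$, and assume that the distribution mismatch coefficient $\kappa_\rho=\sup_\pi\sup_s d_\rho^\pi(s)/\rho(s)$ (with $0/0=0$, and $x/0=\infty$ for $x>0$) is finite. Let $T\ge1$, and let every player run $T$ steps of independent projected policy gradient ascent with stepsize $\eta$: $\pi_i^{(1)}(\cdot\mid s)$ is uniform on $\mathcal A_i$, and for $t=1,\dots,T$, all $i$ and all $s$,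 $$\pi_i^{(t+1)}(\cdot\mid s)=\operatorname*{arg\,max}_{p\in\Delta(\mathcal A_i)}\Big\{\sum_{a_i\in\mathcal A_i} p(a_i)\,\bar Q_i^{\pi^{(t)}}(s,a_i)-\frac1{2\eta}\big\|p-\pi_i^{(t)}(\cdot\mid s)\big\|_2^2\Big\}.$$ Put $$\text{Nash-Regret}(T)=\frac1T\sum_{t=1}^T\max_i\Big(\max_{\pi_i'}V_i^{\pi_i',\pi_{-i}^{(t)}}(\rho)-V_i^{\pi^{(t)}}(\rho)\Big).$$ Then there is a universal constant $C>0$, independent of the game (in particular of $|\mathcal S|$) and of all parameters above, such that $$\text{Nash-Regret}(T)\le C\,\frac{\sqrt{\kappa_\rho A N}\,(\Phi^{\max})^{1/4}}{(1-\gamma)^{9/4}\,T^{1/4}}\quad\text{if }\ \eta=\frac{(1-\gamma)^{5/2}\sqrt{\Phi^{\max}}}{NA\sqrt T},$$ $$\text{Nash-Regret}(T)\le C\,\frac{\kappa_\rho^2\sqrt{A N\,\Phi^{\max}}}{(1-\gamma)^{3}\sqrt T}\quad\text{if }\ \eta=\frac{(1-\gamma)^4}{8\,\kappa_\rho^3NA}.$$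 -/

import Mathlib

/-- Data of an `N`-player infinite-horizon discounted Markov game on a discrete state space `S`
(finite or infinite): player `i` has action set `Act i`, `P s a` is the law of the next state after
the joint action `a` in state `s`, `r i` is the reward of player `i` with values in `[0, 1]`, and
`γ ∈ [0, 1)` is the discount factor. -/
structure MarkovGame (N : ℕ) (S : Type*) (Act : Fin N → Type*) where
  P : S → (∀ i, Act i) → PMF S
  r : Fin N → S → (∀ i, Act i) → ℝ
  r_mem : ∀ i s a, r i s a ∈ Set.Icc (0 : ℝ) 1
  γ : ℝ
  γ_nonneg : 0 ≤ γ
  γ_lt_one : γ < 1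

/-- A stationary stochastic policy of one player with action set `α`. -/
abbrev Policy (S : Type*) (α : Type*) [Fintype α] := S → stdSimplex ℝ α

/-- A Markov product policy: one policy for each player. -/
abbrev JointPolicy {N : ℕ} (S : Type*) (Act : Fin N → Type*) [∀ i, Fintype (Act i)] :=
  ∀ i, Policy S (Act i)

namespace MarkovGame

variable {N : ℕ} {S : Type*} {Act : Fin N → Type*} [∀ i, Fintype (Act i)]

/-- Probability `π(a | s)` of the joint action `a` in state `s`. -/
def jointProb (π : JointPolicy S Act) (s : S) (a : ∀ i, Act i) : ℝ :=
  ∏ i, (π i s).1 (a i)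

/-- `G.law π ν t s a` is the probability of `(s⁽ᵗ⁾, a⁽ᵗ⁾) = (s, a)` when `(s⁽⁰⁾, a⁽⁰⁾)` has law
`ν`, next states are drawn from `P` and all later actions are drawn from `π`. -/
noncomputable def law (G : MarkovGame N S Act) (π : JointPolicy S Act)
    (ν : S → (∀ i, Act i) → ℝ) : ℕ → S → (∀ i, Act i) → ℝ
  | 0 => ν
  | t + 1 => fun s' a' =>
      (∑' s, ∑ a, law G π ν t s a * (G.P s a s').toReal) * jointProb π s' a'

/-- Law of `(s⁽⁰⁾, a⁽⁰⁾)` when `s⁽⁰⁾ = s₀` and `a⁽⁰⁾` is drawn from `π`. -/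
noncomputable def startState (π : JointPolicy S Act) (s₀ : S) : S → (∀ i, Act i) → ℝ :=
  fun s a => (PMF.pure s₀ s).toReal * jointProb π s a

/-- Law of `(s⁽⁰⁾, a⁽⁰⁾)` when `s⁽⁰⁾ = s₀` and `a⁽⁰⁾ = a₀`. -/
noncomputable def startPair (s₀ : S) (a₀ : ∀ i, Act i) : S → (∀ i, Act i) → ℝ :=
  fun s a => (PMF.pure (s₀, a₀) (s, a)).toReal

/-- Expected discounted reward `∑ₜ γᵗ 𝔼[rᵢ(s⁽ᵗ⁾, a⁽ᵗ⁾)]` when `(s⁽⁰⁾, a⁽⁰⁾)` has law `ν`. -/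
noncomputable def expReturn (G : MarkovGame N S Act) (π : JointPolicy S Act)
    (ν : S → (∀ i, Act i) → ℝ) (i : Fin N) : ℝ :=
  ∑' t : ℕ, G.γ ^ t * ∑' s, ∑ a, G.law π ν t s a * G.r i s a

/-- Value function `Vᵢ^π(s)`. -/
noncomputable def V (G : MarkovGame N S Act) (i : Fin N) (π : JointPolicy S Act) (s : S) : ℝ :=
  G.expReturn π (startState π s) i

/-- `Vᵢ^π(μ) = 𝔼_{s ∼ μ} Vᵢ^π(s)`. -/
noncomputable def VDist (G : MarkovGame N S Act) (i : Fin N) (π : JointPolicy S Act)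
    (μ : PMF S) : ℝ :=
  ∑' s, (μ s).toReal * G.V i π s

/-- Action-value function `Qᵢ^π(s, a)`. -/
noncomputable def Q (G : MarkovGame N S Act) (i : Fin N) (π : JointPolicy S Act) (s : S)
    (a : ∀ j, Act j) : ℝ :=
  G.expReturn π (startPair s a) i

open Classical in
/-- Averaged action-value function: the sum over all joint actions in which player `i` plays `aᵢ`,
weighted by the probability that the other players play their part. -/
noncomputable def QBar (G : MarkovGame N S Act) (i : Fin N) (π : JointPolicy S Act) (s : S)
    (ai : Act i) : ℝ :=
  ∑ a ∈ (Finset.univ : Finset (∀ j, Act j)).filter (fun a => a i = ai),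
    (∏ j ∈ Finset.univ.erase i, (π j s).1 (a j)) * G.Q i π s a

/-- `Pr^π(s⁽ᵗ⁾ = s | s⁽⁰⁾ = s₀)`. -/
noncomputable def stateProb (G : MarkovGame N S Act) (π : JointPolicy S Act) (s₀ : S) (t : ℕ)
    (s : S) : ℝ :=
  ∑ a, G.law π (startState π s₀) t s a

/-- Discounted state visitation distribution `d_{s₀}^π(s)`. -/
noncomputable def visit (G : MarkovGame N S Act) (π : JointPolicy S Act) (s₀ s : S) : ℝ :=
  (1 - G.γ) * ∑' t : ℕ, G.γ ^ t * G.stateProb π s₀ t s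

/-- `d_μ^π(s) = 𝔼_{s₀ ∼ μ} d_{s₀}^π(s)`. -/
noncomputable def visitDist (G : MarkovGame N S Act) (π : JointPolicy S Act) (μ : PMF S)
    (s : S) : ℝ :=
  ∑' s₀, (μ s₀).toReal * G.visit π s₀ s

/-- Distribution mismatch coefficient `κ_μ = sup_π ‖d_μ^π / μ‖_∞`, a value in `[0, ∞]`
(with `0 / 0 = 0` and `x / 0 = ∞` for `x > 0`). -/
noncomputable def mismatch (G : MarkovGame N S Act) (μ : PMF S) : ENNReal :=
  ⨆ π : JointPolicy S Act, ⨆ s : S, ENNReal.ofReal (G.visitDist π μ s) / μ s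

/-- `Φ` is a potential function: it captures, at every state, every unilateral change of policy. -/
def IsPotential (G : MarkovGame N S Act) (Φ : JointPolicy S Act → S → ℝ) : Prop :=
  ∀ (i : Fin N) (π : JointPolicy S Act) (p q : Policy S (Act i)) (s : S),
    G.V i (Function.update π i p) s - G.V i (Function.update π i q) s =
      Φ (Function.update π i p) s - Φ (Function.update π i q) s

/-- `|Φ^π(μ) - Φ^π'(μ)| ≤ B` for all `π, π', μ`, the difference of the two expectations over
`s ∼ μ` being written as the expectation of the difference. -/
def PotentialGapLE (Φ : JointPolicy S Act → S → ℝ) (B : ℝ) : Prop :=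
  ∀ (π π' : JointPolicy S Act) (μ : PMF S), |∑' s, (μ s).toReal * (Φ π s - Φ π' s)| ≤ B

/-- `π 1, …, π (T + 1)` are the iterates of `T` steps of independent projected policy gradient
ascent with stepsize `η`, started at the uniform policies. -/
def IsPolicyGradientRun (G : MarkovGame N S Act) (η : ℝ) (T : ℕ)
    (π : ℕ → JointPolicy S Act) : Prop :=
  (∀ i s a, (π 1 i s).1 a = 1 / (Fintype.card (Act i) : ℝ)) ∧
  ∀ t ∈ Finset.Icc 1 T, ∀ i s,
    IsMaxOn
      (fun p : Act i → ℝ =>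
        ∑ a, p a * G.QBar i (π t) s a - 1 / (2 * η) * ∑ a, (p a - (π t i s).1 a) ^ 2)
      (stdSimplex ℝ (Act i)) (π (t + 1) i s).1

/-- `Nash-Regret(T) = (1/T) ∑ₜ maxᵢ (max_{πᵢ'} Vᵢ^{πᵢ', π₋ᵢ⁽ᵗ⁾}(ρ) - Vᵢ^{π⁽ᵗ⁾}(ρ))`. -/
noncomputable def nashRegret (G : MarkovGame N S Act) (ρ : PMF S) (T : ℕ)
    (π : ℕ → JointPolicy S Act) : ℝ :=
  1 / (T : ℝ) * ∑ t ∈ Finset.Icc 1 T, ⨆ i : Fin N,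
    ((⨆ p : Policy S (Act i), G.VDist i (Function.update (π t) i p) ρ) - G.VDist i (π t) ρ)

end MarkovGame

/-! Write g for 1/(1-γ) and κ for the mismatch coefficient. The potential is a Lyapunov function: it
can rise by at most Φmax over the run. If each simultaneous step raises it by about the squared
distance travelled over η, up to a small loss, then the squared distances of all steps sum to O(η
Φmax). A player whose proximal step moves little was already nearly best responding, so this sum
controls the regret.

The difficulty is that all players move at once, while the potential only describes unilateral
moves. Let them switch one at a time (`hybrid`). Against unswitched opponents, player i gains at
least distance²/η at every state (`IsGradientStep.sqDist_le_V_sub`). Replacing opponents by those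
who have already switched costs mixed second differences of V_i, one per pair of players. Such a
difference solves a Bellman equation whose source consists of three terms, each coupling a change by
i with a change by j (`mixed_V_sub_eq`). It is estimated in two ways, one for each stepsize. In sup
norm, ℓ¹ steps of size at most ηAg give a total loss O((NAη)² g⁵) per iteration, free of κ
(`abs_mixed_V_sub_le_of_l1Dist_le`). In ρ-mean, the loss is a multiple NAκ³g⁴ of the squared
distances and is absorbed by the gain when η is small (`abs_expect_mixed_V_sub_le`). The number of
states never enters, because errors are integrated against occupancy laws and moved to ρ by
`expect_resolvent_le`.

The regret then follows from the performance difference lemma `V_sub_V` and the proximal estimate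
`sum_sub_mul_le_of_isMaxOn`. Its Cauchy–Schwarz step is kept as AM–GM with a free parameter, which
is balanced only at the end. -/

/-! ### Bounded functions -/

/-- A real-valued function with bounded range. -/
def BddFun {α : Type*} (f : α → ℝ) : Prop := ∃ B, ∀ x, |f x| ≤ B

namespace BddFun

variable {α : Type*} {f g : α → ℝ}

theorem const (c : ℝ) : BddFun (fun _ : α => c) := ⟨|c|, fun _ => le_rfl⟩

theorem of_mem_Icc {a b : ℝ} (h : ∀ x, f x ∈ Set.Icc a b) : BddFun f :=
  ⟨max |a| |b|, fun x => abs_le_max_abs_abs (h x).1 (h x).2⟩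

theorem add (hf : BddFun f) (hg : BddFun g) : BddFun (fun x => f x + g x) := by
  obtain ⟨B, hB⟩ := hf
  obtain ⟨D, hD⟩ := hg
  exact ⟨B + D, fun x => (abs_add_le _ _).trans (add_le_add (hB x) (hD x))⟩

theorem mul (hf : BddFun f) (hg : BddFun g) : BddFun (fun x => f x * g x) := by
  obtain ⟨B, hB⟩ := hf
  obtain ⟨D, hD⟩ := hg
  refine ⟨B * D, fun x => ?_⟩
  rw [abs_mul]
  exact mul_le_mul (hB x) (hD x) (abs_nonneg _) ((abs_nonneg _).trans (hB x))

theorem const_mul (c : ℝ) (hf : BddFun f) : BddFun (fun x => c * f x) := (const c).mul hf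

theorem neg (hf : BddFun f) : BddFun (fun x => -f x) := by
  simpa using hf.const_mul (-1)

theorem sub (hf : BddFun f) (hg : BddFun g) : BddFun (fun x => f x - g x) := by
  simpa [sub_eq_add_neg] using hf.add hg.neg

theorem abs (hf : BddFun f) : BddFun (fun x => |f x|) := by
  obtain ⟨B, hB⟩ := hf
  exact ⟨B, fun x => by simpa using hB x⟩

theorem pow (hf : BddFun f) (n : ℕ) : BddFun (fun x => f x ^ n) := by
  induction n with
  | zero => simpa using const 1
  | succ n ih => simpa [pow_succ] using ih.mul hf

theorem sum {ι : Type*} (s : Finset ι) {f : ι → α → ℝ} (hf : ∀ i ∈ s, BddFun (f i)) :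
    BddFun (fun x => ∑ i ∈ s, f i x) := by
  classical
  induction s using Finset.induction_on with
  | empty => simpa using const 0
  | insert i s hi ih =>
    simp only [Finset.sum_insert hi]
    exact (hf i (by simp)).add (ih fun j hj => hf j (by simp [hj]))

theorem comp {β : Type*} (hf : BddFun f) (g : β → α) : BddFun (fun x => f (g x)) := by
  obtain ⟨B, hB⟩ := hf
  exact ⟨B, fun x => hB _⟩

theorem of_abs_le (hg : BddFun g) (h : ∀ x, |f x| ≤ g x) : BddFun f := by
  obtain ⟨B, hB⟩ := hg
  exact ⟨B, fun x => (h x).trans ((le_abs_self _).trans (hB x))⟩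

end BddFun

/-! ### Expectations under discrete laws and geometric discounting -/

namespace PMF

variable {α β : Type*} (μ : PMF α) {f g : α → ℝ}

/-- The expectation of a real-valued function under a probability mass function. -/
noncomputable def expect (f : α → ℝ) : ℝ := ∑' x, (μ x).toReal * f x

theorem summable_toReal : Summable fun x => (μ x).toReal :=
  ENNReal.summable_toReal μ.tsum_coe_ne_top

theorem tsum_toReal : ∑' x, (μ x).toReal = 1 := by
  rw [← ENNReal.tsum_toReal_eq fun a => μ.apply_ne_top a, μ.tsum_coe, ENNReal.toReal_one]

theorem summable_expect (hf : BddFun f) : Summable fun x => (μ x).toReal * f x := by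
  obtain ⟨B, hB⟩ := hf
  refine Summable.of_norm_bounded (μ.summable_toReal.mul_right B) fun x => ?_
  rw [Real.norm_eq_abs, abs_mul, abs_of_nonneg ENNReal.toReal_nonneg]
  exact mul_le_mul_of_nonneg_left (hB x) ENNReal.toReal_nonneg

theorem expect_const (c : ℝ) : μ.expect (fun _ => c) = c := by
  rw [expect, tsum_mul_right, tsum_toReal, one_mul]

theorem expect_add (hf : BddFun f) (hg : BddFun g) :
    μ.expect (fun x => f x + g x) = μ.expect f + μ.expect g := by
  simp only [expect, mul_add]
  exact (μ.summable_expect hf).tsum_add (μ.summable_expect hg)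

theorem expect_const_mul (c : ℝ) (f : α → ℝ) :
    μ.expect (fun x => c * f x) = c * μ.expect f := by
  simp only [expect, ← tsum_mul_left]
  exact tsum_congr fun x => by ring

theorem expect_sub (hf : BddFun f) (hg : BddFun g) :
    μ.expect (fun x => f x - g x) = μ.expect f - μ.expect g := by
  simp only [expect, mul_sub]
  exact (μ.summable_expect hf).tsum_sub (μ.summable_expect hg)

theorem expect_sum {ι : Type*} (s : Finset ι) {f : ι → α → ℝ} (hf : ∀ i ∈ s, BddFun (f i)) :
    μ.expect (fun x => ∑ i ∈ s, f i x) = ∑ i ∈ s, μ.expect (f i) := by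
  simp only [expect, Finset.mul_sum]
  exact Summable.tsum_finsetSum fun i hi => μ.summable_expect (hf i hi)

theorem expect_mono (hf : BddFun f) (hg : BddFun g) (h : ∀ x, f x ≤ g x) :
    μ.expect f ≤ μ.expect g :=
  (μ.summable_expect hf).tsum_le_tsum
    (fun x => mul_le_mul_of_nonneg_left (h x) ENNReal.toReal_nonneg) (μ.summable_expect hg)

theorem expect_nonneg (h : ∀ x, 0 ≤ f x) : 0 ≤ μ.expect f :=
  tsum_nonneg fun x => mul_nonneg ENNReal.toReal_nonneg (h x)

theorem expect_le (hf : BddFun f) {c : ℝ} (h : ∀ x, f x ≤ c) : μ.expect f ≤ c :=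
  (μ.expect_mono hf (.const c) h).trans_eq (μ.expect_const c)

theorem abs_expect_le_expect_abs (hf : BddFun f) : |μ.expect f| ≤ μ.expect fun x => |f x| := by
  rw [abs_le]
  constructor
  · have := μ.expect_mono (hf.abs.const_mul (-1)) hf fun x => by
      have := neg_abs_le (f x); linarith
    rw [expect_const_mul] at this
    linarith
  · exact μ.expect_mono hf hf.abs fun x => le_abs_self _

theorem abs_expect_le (hf : BddFun f) {c : ℝ} (h : ∀ x, |f x| ≤ c) : |μ.expect f| ≤ c :=
  (μ.abs_expect_le_expect_abs hf).trans (μ.expect_le hf.abs h)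

theorem expect_sq_le (hf : BddFun f) : μ.expect f ^ 2 ≤ μ.expect fun x => f x ^ 2 := by
  -- Nonnegativity of the variance, expanded.
  have h := μ.expect_nonneg (f := fun x => (f x ^ 2 - 2 * μ.expect f * f x) + μ.expect f ^ 2)
    fun x => by nlinarith [sq_nonneg (f x - μ.expect f)]
  rw [expect_add _ ((hf.pow 2).sub (hf.const_mul _)) (.const _),
    expect_sub _ (hf.pow 2) (hf.const_mul _), expect_const_mul, expect_const] at h
  linarith

theorem bddFun_expect (k : β → PMF α) (hf : BddFun f) : BddFun fun x => (k x).expect f := by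
  obtain ⟨B, hB⟩ := hf
  exact ⟨B, fun x => (k x).abs_expect_le ⟨B, hB⟩ hB⟩

theorem toReal_bind_apply (k : α → PMF β) (y : β) :
    (μ.bind k y).toReal = μ.expect fun x => (k x y).toReal := by
  rw [bind_apply, ENNReal.tsum_toReal_eq]
  · simp [expect]
  · exact fun x => ENNReal.mul_ne_top (μ.apply_ne_top x) ((k x).apply_ne_top y)

theorem expect_bind (k : α → PMF β) {f : β → ℝ} (hf : BddFun f) :
    (μ.bind k).expect f = μ.expect fun x => (k x).expect f := by
  have hs : Summable (Function.uncurry fun x y => (μ x).toReal * (k x y).toReal * f y) := by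
    obtain ⟨B, hB⟩ := hf
    have h1 : Summable fun p : α × β => (μ p.1).toReal * (k p.1 p.2).toReal := by
      have hn : ∀ p : α × β, 0 ≤ (μ p.1).toReal * (k p.1 p.2).toReal := fun p =>
        mul_nonneg ENNReal.toReal_nonneg ENNReal.toReal_nonneg
      have hk : ∀ x, Summable fun y => (μ x).toReal * (k x y).toReal := fun x =>
        (k x).summable_toReal.mul_left (μ x).toReal
      have e : ∀ x, ∑' y, (μ x).toReal * (k x y).toReal = (μ x).toReal := fun x => by
        rw [tsum_mul_left, tsum_toReal, mul_one]
      refine (summable_prod_of_nonneg hn).2 ⟨hk, ?_⟩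
      exact μ.summable_toReal.congr fun x => (e x).symm
    refine Summable.of_norm_bounded (h1.mul_right B) fun p => ?_
    simp only [Function.uncurry, Real.norm_eq_abs, abs_mul, abs_of_nonneg ENNReal.toReal_nonneg]
    exact mul_le_mul_of_nonneg_left (hB _)
      (mul_nonneg ENNReal.toReal_nonneg ENNReal.toReal_nonneg)
  calc (μ.bind k).expect f = ∑' y, ∑' x, (μ x).toReal * (k x y).toReal * f y := by
        refine tsum_congr fun y => ?_
        rw [toReal_bind_apply, expect, tsum_mul_right]
    _ = ∑' x, ∑' y, (μ x).toReal * (k x y).toReal * f y := hs.tsum_comm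
    _ = _ := by
        refine tsum_congr fun x => ?_
        simp only [expect, mul_assoc, tsum_mul_left]

theorem expect_pure (a : α) (f : α → ℝ) : (PMF.pure a).expect f = f a := by
  classical
  rw [expect, tsum_eq_single a]
  · simp
  · intro b hb
    simp [hb]

theorem expect_swap (ν : PMF β) {f : α → β → ℝ} (hf : BddFun fun p : α × β => f p.1 p.2) :
    μ.expect (fun x => ν.expect (f x)) = ν.expect fun y => μ.expect fun x => f x y := by
  -- Fubini is read off from the fact that two independent draws commute.
  have h := congrArg (fun κ : PMF (α × β) => κ.expect fun p => f p.1 p.2)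
    (PMF.bind_comm μ ν fun x y => PMF.pure (x, y))
  have e : ∀ x, (ν.bind fun y => PMF.pure (x, y)).expect (fun p : α × β => f p.1 p.2) =
      ν.expect (f x) := fun x => by
    rw [expect_bind _ _ hf]; simp only [expect_pure]
  have e' : ∀ y, (μ.bind fun x => PMF.pure (x, y)).expect (fun p : α × β => f p.1 p.2) =
      μ.expect fun x => f x y := fun y => by
    rw [expect_bind _ _ hf]; simp only [expect_pure]
  simp only [expect_bind _ _ hf] at h
  simpa only [expect_bind _ _ hf, expect_pure] using h

/-- The geometric distribution on `ℕ` with weights `(1 - γ) γᵗ`. -/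
noncomputable def discount (γ : ℝ) (h0 : 0 ≤ γ) (h1 : γ < 1) : PMF ℕ :=
  ⟨fun t => ENNReal.ofReal ((1 - γ) * γ ^ t), by
    have h : HasSum (fun t : ℕ => (1 - γ) * γ ^ t) 1 := by
      have := (hasSum_geometric_of_lt_one h0 h1).mul_left (1 - γ)
      rwa [mul_inv_cancel₀ (by linarith)] at this
    have hn : ∀ t : ℕ, 0 ≤ (1 - γ) * γ ^ t := fun t =>
      mul_nonneg (by linarith) (pow_nonneg h0 t)
    have e := ENNReal.ofReal_tsum_of_nonneg hn h.summable
    rw [h.tsum_eq, ENNReal.ofReal_one] at e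
    rw [e]
    exact ENNReal.summable.hasSum⟩

variable {γ : ℝ} (h0 : 0 ≤ γ) (h1 : γ < 1)

theorem expect_discount (g : ℕ → ℝ) :
    (discount γ h0 h1).expect g = (1 - γ) * ∑' t, γ ^ t * g t := by
  rw [expect, ← tsum_mul_left]
  refine tsum_congr fun t => ?_
  have : discount γ h0 h1 t = ENNReal.ofReal ((1 - γ) * γ ^ t) := rfl
  rw [this, ENNReal.toReal_ofReal (mul_nonneg (by linarith) (pow_nonneg h0 t))]
  ring

theorem summable_discount (h0 : 0 ≤ γ) (h1 : γ < 1) {g : ℕ → ℝ} (hg : BddFun g) : Summable fun t => γ ^ t * g t := by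
  obtain ⟨B, hB⟩ := hg
  refine Summable.of_norm_bounded ((summable_geometric_of_lt_one h0 h1).mul_right B) fun t => ?_
  rw [Real.norm_eq_abs, abs_mul, abs_of_nonneg (pow_nonneg h0 t)]
  exact mul_le_mul_of_nonneg_left (hB t) (pow_nonneg h0 t)

theorem expect_discount_succ {g : ℕ → ℝ} (hg : BddFun g) :
    (discount γ h0 h1).expect g =
      (1 - γ) * g 0 + γ * (discount γ h0 h1).expect fun t => g (t + 1) := by
  rw [expect_discount, expect_discount, (summable_discount h0 h1 hg).tsum_eq_zero_add]
  simp only [pow_succ', pow_zero, mul_assoc, tsum_mul_left]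
  ring

end PMF

/-! ### Occupancy laws, Bellman equations and performance differences -/

namespace MarkovGame

variable {N : ℕ} {S : Type*} {Act : Fin N → Type*}

theorem one_sub_γ_pos {G : MarkovGame N S Act} : 0 < 1 - G.γ := sub_pos.2 G.γ_lt_one

theorem one_le_inv_one_sub_γ {G : MarkovGame N S Act} : 1 ≤ (1 - G.γ)⁻¹ :=
  (one_le_inv₀ one_sub_γ_pos).2 (by linarith [G.γ_nonneg])

variable [∀ i, Fintype (Act i)]

theorem jointProb_nonneg (π : JointPolicy S Act) (s : S) (a : ∀ i, Act i) :
    0 ≤ jointProb π s a :=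
  Finset.prod_nonneg fun i _ => (π i s).2.1 (a i)

theorem sum_jointProb (π : JointPolicy S Act) (s : S) : ∑ a, jointProb π s a = 1 := by
  simp only [jointProb]
  rw [← Fintype.prod_sum fun i b => (π i s).1 b]
  exact Finset.prod_eq_one fun i _ => (π i s).2.2

/-- The average over the joint action drawn from `π` of a function of state and joint action. -/
def actionAvg (π : JointPolicy S Act) (F : S → (∀ i, Act i) → ℝ) (s : S) : ℝ :=
  ∑ a, jointProb π s a * F s a

theorem actionAvg_mono (π : JointPolicy S Act) {F H : S → (∀ i, Act i) → ℝ} {s : S}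
    (h : ∀ a, F s a ≤ H s a) : actionAvg π F s ≤ actionAvg π H s :=
  Finset.sum_le_sum fun a _ => mul_le_mul_of_nonneg_left (h a) (jointProb_nonneg π s a)

theorem actionAvg_const (π : JointPolicy S Act) (c : ℝ) (s : S) :
    actionAvg π (fun _ _ => c) s = c := by
  rw [actionAvg, ← Finset.sum_mul, sum_jointProb, one_mul]

theorem actionAvg_add (π : JointPolicy S Act) (F H : S → (∀ i, Act i) → ℝ) (s : S) :
    actionAvg π (fun s a => F s a + H s a) s = actionAvg π F s + actionAvg π H s := by
  simp only [actionAvg, mul_add, Finset.sum_add_distrib]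

theorem actionAvg_const_mul (π : JointPolicy S Act) (c : ℝ) (F : S → (∀ i, Act i) → ℝ) (s : S) :
    actionAvg π (fun s a => c * F s a) s = c * actionAvg π F s := by
  simp only [actionAvg, Finset.mul_sum]
  exact Finset.sum_congr rfl fun a _ => by ring

theorem actionAvg_mem_Icc (π : JointPolicy S Act) {F : S → (∀ i, Act i) → ℝ} {B : ℝ}
    (h : ∀ s a, F s a ∈ Set.Icc 0 B) (s : S) : actionAvg π F s ∈ Set.Icc 0 B := by
  constructor
  · rw [← actionAvg_const π 0 s]
    exact actionAvg_mono π fun a => (h s a).1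
  · rw [← actionAvg_const π B s]
    exact actionAvg_mono π fun a => (h s a).2

/-- The law of the joint action drawn from `π` in state `s`. -/
noncomputable def actionLaw (π : JointPolicy S Act) (s : S) : PMF (∀ i, Act i) :=
  PMF.ofFintype (fun a => ENNReal.ofReal (jointProb π s a)) (by
    rw [← ENNReal.ofReal_sum_of_nonneg fun a _ => jointProb_nonneg π s a, sum_jointProb,
      ENNReal.ofReal_one])

variable (G : MarkovGame N S Act)

/-- The law of the next state when the joint action is drawn from `π`. -/
noncomputable def kernel (π : JointPolicy S Act) (s : S) : PMF S :=
  (actionLaw π s).bind (G.P s)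

theorem expect_actionLaw (π : JointPolicy S Act) (s : S) (f : (∀ i, Act i) → ℝ) :
    (actionLaw π s).expect f = ∑ a, jointProb π s a * f a := by
  rw [PMF.expect, tsum_fintype]
  refine Finset.sum_congr rfl fun a _ => ?_
  rw [actionLaw, PMF.ofFintype_apply, ENNReal.toReal_ofReal (jointProb_nonneg π s a)]

theorem expect_kernel (π : JointPolicy S Act) (s : S) {f : S → ℝ} (hf : BddFun f) :
    (G.kernel π s).expect f = actionAvg π (fun s a => (G.P s a).expect f) s := by
  rw [kernel, PMF.expect_bind _ _ hf, expect_actionLaw, actionAvg]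

theorem toReal_kernel_apply (π : JointPolicy S Act) (s s' : S) :
    (G.kernel π s s').toReal = ∑ a, jointProb π s a * (G.P s a s').toReal := by
  rw [kernel, PMF.toReal_bind_apply, expect_actionLaw]

/-- The law of the state after `t` steps of `π`. -/
noncomputable def stateLaw (π : JointPolicy S Act) : ℕ → S → PMF S
  | 0 => PMF.pure
  | t + 1 => fun s => (stateLaw π t s).bind (G.kernel π)

theorem stateLaw_succ' (π : JointPolicy S Act) (t : ℕ) (s : S) :
    G.stateLaw π (t + 1) s = (G.kernel π s).bind (G.stateLaw π t) := by
  induction t with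
  | zero => simp [stateLaw]
  | succ t ih =>
    change (G.stateLaw π (t + 1) s).bind (G.kernel π) = _
    rw [ih, PMF.bind_bind]; rfl

theorem law_step (π : JointPolicy S Act) (μ : PMF S) (s' : S) :
    ∑' s, ∑ a, (μ s).toReal * jointProb π s a * (G.P s a s').toReal =
      (μ.bind (G.kernel π) s').toReal := by
  rw [PMF.toReal_bind_apply, PMF.expect]
  refine tsum_congr fun s => ?_
  rw [toReal_kernel_apply, Finset.mul_sum]
  exact Finset.sum_congr rfl fun a _ => by ring

theorem law_startState (π : JointPolicy S Act) (s₀ : S) (t : ℕ) (s : S) (a : ∀ i, Act i) :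
    G.law π (startState π s₀) t s a = (G.stateLaw π t s₀ s).toReal * jointProb π s a := by
  induction t generalizing s a with
  | zero => rfl
  | succ t ih => simp only [law, ih, law_step]; rfl

/-- The prescribed first action matters only through the first transition; from then on `π` acts, so
time `t + 1` here is time `t` for a chain started from `P s₀ a₀`. -/
theorem law_startPair_succ (π : JointPolicy S Act) (s₀ : S) (a₀ : ∀ i, Act i) (t : ℕ) (s : S)
    (a : ∀ i, Act i) :
    G.law π (startPair s₀ a₀) (t + 1) s a =
      ((G.P s₀ a₀).bind (G.stateLaw π t) s).toReal * jointProb π s a := by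
  classical
  induction t generalizing s a with
  | zero =>
    simp only [law]
    congr 1
    rw [tsum_eq_single s₀, Finset.sum_eq_single a₀]
    · simp [startPair, stateLaw]
    · intro b _ hb
      simp [startPair, hb]
    · simp
    · intro b hb
      simp [startPair, hb]
  | succ t ih =>
    simp only [law] at ih ⊢
    simp only [ih, law_step, PMF.bind_bind]
    rfl

/-- The discounted state occupancy law of `π` started at `s`. -/
noncomputable def occupancy (π : JointPolicy S Act) (s : S) : PMF S :=
  (PMF.discount G.γ G.γ_nonneg G.γ_lt_one).bind fun t => G.stateLaw π t s

/-- The expected discounted sum of a function of the state along `π`. -/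
noncomputable def resolvent (π : JointPolicy S Act) (f : S → ℝ) (s : S) : ℝ :=
  (1 - G.γ)⁻¹ * (G.occupancy π s).expect f

variable {G} {π : JointPolicy S Act} {f g : S → ℝ}

theorem bddFun_kernel (hf : BddFun f) : BddFun fun s => (G.kernel π s).expect f :=
  PMF.bddFun_expect _ hf

theorem bddFun_resolvent (hf : BddFun f) : BddFun (G.resolvent π f) :=
  (PMF.bddFun_expect _ hf).const_mul _

theorem resolvent_mono (hf : BddFun f) (hg : BddFun g) (h : ∀ s, f s ≤ g s) (s : S) :
    G.resolvent π f s ≤ G.resolvent π g s :=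
  mul_le_mul_of_nonneg_left (PMF.expect_mono _ hf hg h) (inv_nonneg.2 one_sub_γ_pos.le)

theorem resolvent_const (c : ℝ) (s : S) :
    G.resolvent π (fun _ => c) s = (1 - G.γ)⁻¹ * c := by
  rw [resolvent, PMF.expect_const]

theorem resolvent_le (hf : BddFun f) {c : ℝ} (h : ∀ s, f s ≤ c) (s : S) :
    G.resolvent π f s ≤ (1 - G.γ)⁻¹ * c :=
  (resolvent_mono hf (.const c) h s).trans_eq (resolvent_const c s)

theorem resolvent_add (hf : BddFun f) (hg : BddFun g) (s : S) :
    G.resolvent π (fun s => f s + g s) s = G.resolvent π f s + G.resolvent π g s := by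
  simp only [resolvent, PMF.expect_add _ hf hg, mul_add]

theorem abs_resolvent_le (hf : BddFun f) (s : S) :
    |G.resolvent π f s| ≤ G.resolvent π (fun s => |f s|) s := by
  rw [resolvent, abs_mul, abs_of_pos (inv_pos.2 one_sub_γ_pos)]
  exact mul_le_mul_of_nonneg_left (PMF.abs_expect_le_expect_abs _ hf)
    (inv_nonneg.2 one_sub_γ_pos.le)

theorem resolvent_sq_le (hf : BddFun f) (s : S) :
    G.resolvent π f s ^ 2 ≤ (1 - G.γ)⁻¹ * G.resolvent π (fun s => f s ^ 2) s := by
  rw [resolvent, resolvent, mul_pow, sq (1 - G.γ)⁻¹, mul_assoc]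
  have h := inv_nonneg.2 (one_sub_γ_pos (G := G)).le
  exact mul_le_mul_of_nonneg_left (mul_le_mul_of_nonneg_left (PMF.expect_sq_le _ hf) h) h

theorem expect_occupancy (hf : BddFun f) (s : S) :
    (G.occupancy π s).expect f =
      (PMF.discount G.γ G.γ_nonneg G.γ_lt_one).expect fun t => (G.stateLaw π t s).expect f :=
  PMF.expect_bind _ _ hf

theorem expect_stateLaw_succ (hf : BddFun f) (t : ℕ) (s : S) :
    (G.stateLaw π (t + 1) s).expect f =
      (G.stateLaw π t s).expect fun s' => (G.kernel π s').expect f :=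
  PMF.expect_bind _ _ hf

theorem expect_stateLaw_zero (s : S) : (G.stateLaw π 0 s).expect f = f s :=
  PMF.expect_pure s f

theorem bddFun_stateLaw (hf : BddFun f) (s : S) :
    BddFun fun t => (G.stateLaw π t s).expect f :=
  PMF.bddFun_expect (fun t => G.stateLaw π t s) hf

/-- A bounded solution of the Bellman equation with source `f` is the resolvent of `f`. -/
theorem eq_resolvent {X : S → ℝ} (hX : BddFun X) (hf : BddFun f)
    (h : ∀ s, X s = f s + G.γ * (G.kernel π s).expect X) (s : S) : X s = G.resolvent π f s := by
  have hK : BddFun fun s => (G.kernel π s).expect X := bddFun_kernel hX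
  have hf' : f = fun s => X s - G.γ * (G.kernel π s).expect X := by
    funext s; linarith [h s]
  -- The source at time `t` is x_t - γ x_{t+1}, where x_t is the mean of `X` at time `t`; the
  -- discounted series telescopes to x_0 = `X s`.
  have e : ∀ t, (G.stateLaw π t s).expect f =
      (G.stateLaw π t s).expect X - G.γ * (G.stateLaw π (t + 1) s).expect X := fun t => by
    rw [expect_stateLaw_succ hX, hf', PMF.expect_sub _ hX (hK.const_mul _),
      PMF.expect_const_mul]
  have hb := bddFun_stateLaw (G := G) (π := π) hX s
  rw [resolvent, expect_occupancy hf]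
  simp only [e]
  rw [PMF.expect_sub _ hb ((hb.comp fun t => t + 1).const_mul _), PMF.expect_const_mul,
    PMF.expect_discount_succ _ _ hb, expect_stateLaw_zero]
  have := (one_sub_γ_pos (G := G)).ne'
  field_simp
  ring

theorem expect_resolvent (hf : BddFun f) (μ : PMF S) :
    μ.expect (G.resolvent π f) = (1 - G.γ)⁻¹ *
      (PMF.discount G.γ G.γ_nonneg G.γ_lt_one).expect fun t =>
        (μ.bind (G.stateLaw π t)).expect f := by
  have e : G.resolvent π f = fun s => (1 - G.γ)⁻¹ * (G.occupancy π s).expect f := rfl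
  rw [e, PMF.expect_const_mul]
  simp only [expect_occupancy hf, PMF.expect_bind _ _ hf]
  rw [PMF.expect_swap]
  obtain ⟨B, hB⟩ := hf
  exact ⟨B, fun p => PMF.abs_expect_le _ ⟨B, hB⟩ hB⟩

theorem resolvent_bellman (hf : BddFun f) (s : S) :
    G.resolvent π f s = f s + G.γ * (G.kernel π s).expect (G.resolvent π f) := by
  rw [expect_resolvent hf, resolvent, expect_occupancy hf,
    PMF.expect_discount_succ _ _ (bddFun_stateLaw hf s), expect_stateLaw_zero]
  simp only [stateLaw_succ']
  have := (one_sub_γ_pos (G := G)).ne'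
  field_simp

theorem resolvent_nonneg (h : ∀ s, 0 ≤ f s) (s : S) : 0 ≤ G.resolvent π f s :=
  mul_nonneg (inv_nonneg.2 one_sub_γ_pos.le) (PMF.expect_nonneg _ h)

theorem le_resolvent (hf : BddFun f) (h : ∀ s, 0 ≤ f s) (s : S) : f s ≤ G.resolvent π f s := by
  rw [resolvent_bellman hf]
  exact le_add_of_nonneg_right
    (mul_nonneg G.γ_nonneg (PMF.expect_nonneg _ fun s => resolvent_nonneg h s))

/-- This is the time-one term of the discounted series. It turns a one-step transition into an
occupancy, the only kind of law that the mismatch coefficient controls. -/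
theorem kernel_le_resolvent (hf : BddFun f) (h : ∀ s, 0 ≤ f s) (s : S) :
    G.γ * (G.kernel π s).expect f ≤ G.resolvent π f s := by
  rw [resolvent_bellman hf]
  have := mul_le_mul_of_nonneg_left
    (PMF.expect_mono (G.kernel π s) hf (bddFun_resolvent hf)
      (le_resolvent (G := G) (π := π) hf h))
    G.γ_nonneg
  linarith [h s]

theorem bddFun_reward (i : Fin N) : BddFun (actionAvg π (G.r i) : S → ℝ) :=
  .of_mem_Icc (actionAvg_mem_Icc π (G.r_mem i))

theorem V_eq_resolvent (i : Fin N) (π : JointPolicy S Act) (s : S) :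
    G.V i π s = G.resolvent π (actionAvg π (G.r i)) s := by
  rw [resolvent, expect_occupancy (bddFun_reward i), PMF.expect_discount, ← mul_assoc,
    inv_mul_cancel₀ one_sub_γ_pos.ne', one_mul, V, expReturn]
  refine tsum_congr fun t => ?_
  simp only [law_startState, PMF.expect, actionAvg, Finset.mul_sum, mul_assoc]

theorem Q_eq (i : Fin N) (π : JointPolicy S Act) (s : S) (a : ∀ j, Act j) :
    G.Q i π s a = G.r i s a + G.γ * (G.P s a).expect (G.V i π) := by
  classical
  have hr : BddFun (actionAvg π (G.r i)) := bddFun_reward i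
  have hV : G.V i π = G.resolvent π (actionAvg π (G.r i)) := funext fun s => V_eq_resolvent i π s
  have e : ∀ t, ∑' s', ∑ a', G.law π (startPair s a) (t + 1) s' a' * G.r i s' a' =
      ((G.P s a).bind (G.stateLaw π t)).expect (actionAvg π (G.r i)) := fun t => by
    simp only [law_startPair_succ, PMF.expect, actionAvg, Finset.mul_sum, mul_assoc]
  have e0 : ∑' s', ∑ a', G.law π (startPair s a) 0 s' a' * G.r i s' a' = G.r i s a := by
    rw [tsum_eq_single s, Finset.sum_eq_single a]
    · simp [law, startPair]
    · intro b _ hb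
      simp [law, startPair, hb]
    · simp
    · intro b hb
      simp [law, startPair, hb]
  have hb : BddFun fun t => ((G.P s a).bind (G.stateLaw π t)).expect (actionAvg π (G.r i)) :=
    PMF.bddFun_expect (fun t => (G.P s a).bind (G.stateLaw π t)) hr
  have hsum := PMF.summable_discount G.γ_nonneg G.γ_lt_one hb
  rw [hV, expect_resolvent hr, PMF.expect_discount,
    inv_mul_cancel_left₀ one_sub_γ_pos.ne', Q, expReturn, Summable.tsum_eq_zero_add, e0, pow_zero, one_mul,
    ← tsum_mul_left]
  · simp only [e, pow_succ', mul_assoc]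
  · rw [← summable_nat_add_iff 1]
    simp only [e, pow_succ', mul_assoc]
    exact hsum.mul_left _

theorem bddFun_V (i : Fin N) : BddFun (G.V i π) := by
  have : G.V i π = G.resolvent π (actionAvg π (G.r i)) := funext fun s => V_eq_resolvent i π s
  rw [this]
  exact bddFun_resolvent (bddFun_reward i)

theorem V_mem_Icc (i : Fin N) (π : JointPolicy S Act) (s : S) :
    G.V i π s ∈ Set.Icc 0 (1 - G.γ)⁻¹ := by
  rw [V_eq_resolvent]
  have h := actionAvg_mem_Icc π (G.r_mem i)
  exact ⟨resolvent_nonneg (fun s => (h s).1) s,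
    (resolvent_le (bddFun_reward i) (fun s => (h s).2) s).trans_eq (mul_one _)⟩

theorem Q_mem_Icc (i : Fin N) (π : JointPolicy S Act) (s : S) (a : ∀ j, Act j) :
    G.Q i π s a ∈ Set.Icc 0 (1 - G.γ)⁻¹ := by
  rw [Q_eq]
  have h1 := PMF.expect_nonneg (G.P s a) fun s => (V_mem_Icc (G := G) i π s).1
  have h2 := PMF.expect_le (G.P s a) (bddFun_V i) fun s => (V_mem_Icc (G := G) i π s).2
  have h3 := G.r_mem i s a
  refine ⟨add_nonneg h3.1 (mul_nonneg G.γ_nonneg h1), ?_⟩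
  calc _ ≤ 1 + G.γ * (1 - G.γ)⁻¹ := add_le_add h3.2 (mul_le_mul_of_nonneg_left h2 G.γ_nonneg)
    _ = (1 - G.γ)⁻¹ := by
      have := (one_sub_γ_pos (G := G)).ne'
      field_simp
      ring

theorem actionAvg_Q (i : Fin N) (π π' : JointPolicy S Act) (s : S) :
    actionAvg π' (G.Q i π) s =
      actionAvg π' (G.r i) s + G.γ * (G.kernel π' s).expect (G.V i π) := by
  have : G.Q i π = fun s a => G.r i s a + G.γ * (G.P s a).expect (G.V i π) := by
    funext s a; exact Q_eq i π s a
  rw [this, actionAvg_add, expect_kernel _ _ _ (bddFun_V i), ← actionAvg_const_mul]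

theorem V_eq_actionAvg_Q (i : Fin N) (π : JointPolicy S Act) (s : S) :
    G.V i π s = actionAvg π (G.Q i π) s := by
  have hV : G.V i π = G.resolvent π (actionAvg π (G.r i)) := funext fun s => V_eq_resolvent i π s
  rw [actionAvg_Q, hV]
  exact resolvent_bellman (bddFun_reward i) s

theorem bddFun_actionAvg_Q (i : Fin N) (π π' : JointPolicy S Act) :
    BddFun (actionAvg π' (G.Q i π)) :=
  .of_mem_Icc (actionAvg_mem_Icc π' (Q_mem_Icc i π))

/-- Changing only the current action law, with the continuation still valued by `π`, produces the
advantage; what is left is the value difference at the next state. -/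
theorem V_sub_V_bellman (i : Fin N) (π π' : JointPolicy S Act) (s : S) :
    G.V i π' s - G.V i π s = actionAvg π' (G.Q i π) s - actionAvg π (G.Q i π) s +
      G.γ * (G.kernel π' s).expect fun s => G.V i π' s - G.V i π s := by
  rw [PMF.expect_sub _ (bddFun_V i) (bddFun_V i), V_eq_actionAvg_Q i π', V_eq_actionAvg_Q i π,
    actionAvg_Q i π' π', actionAvg_Q i π π']
  ring

/-- The performance difference lemma. -/
theorem V_sub_V (i : Fin N) (π π' : JointPolicy S Act) (s : S) :
    G.V i π' s - G.V i π s =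
      G.resolvent π' (fun s => actionAvg π' (G.Q i π) s - actionAvg π (G.Q i π) s) s :=
  eq_resolvent ((bddFun_V i).sub (bddFun_V i))
    ((bddFun_actionAvg_Q i π π').sub (bddFun_actionAvg_Q i π π)) (V_sub_V_bellman i π π') s

end MarkovGame

/-! ### Change of measure and the effect of unilateral changes -/

namespace MarkovGame

variable {N : ℕ} {S : Type*} {Act : Fin N → Type*} [∀ i, Fintype (Act i)]
  {G : MarkovGame N S Act}

theorem visit_eq (π : JointPolicy S Act) (s₀ s : S) :
    G.visit π s₀ s = (G.occupancy π s₀ s).toReal := by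
  rw [occupancy, PMF.toReal_bind_apply, PMF.expect_discount, visit]
  congr 1
  refine tsum_congr fun t => ?_
  simp only [stateProb, law_startState]
  rw [← Finset.mul_sum, sum_jointProb, mul_one]

theorem visitDist_eq (π : JointPolicy S Act) (ρ : PMF S) (s : S) :
    G.visitDist π ρ s = (ρ.bind (G.occupancy π) s).toReal := by
  rw [PMF.toReal_bind_apply]
  simp only [visitDist, visit_eq, PMF.expect]

theorem bind_occupancy_le {ρ : PMF S} (hκ : G.mismatch ρ ≠ ⊤) (π : JointPolicy S Act) (s : S) :
    (ρ.bind (G.occupancy π) s).toReal ≤ (G.mismatch ρ).toReal * (ρ s).toReal := by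
  have h : ENNReal.ofReal (G.visitDist π ρ s) / ρ s ≤ G.mismatch ρ :=
    (le_iSup (fun s => ENNReal.ofReal (G.visitDist π ρ s) / ρ s) s).trans
      (le_iSup (fun π => ⨆ s, ENNReal.ofReal (G.visitDist π ρ s) / ρ s) π)
  -- States with `ρ s = 0` are covered too: finiteness of κ excludes the value x/0 = ∞.
  rw [ENNReal.div_le_iff_le_mul (.inr hκ) (.inl (ρ.apply_ne_top s)), visitDist_eq,
    ENNReal.ofReal_toReal (PMF.apply_ne_top _ _)] at h
  rw [← ENNReal.toReal_mul]
  exact ENNReal.toReal_mono (ENNReal.mul_ne_top hκ (ρ.apply_ne_top s)) h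

/-- Change of measure from the occupancy of any policy to the initial distribution. -/
theorem expect_resolvent_le {ρ : PMF S} (hκ : G.mismatch ρ ≠ ⊤) (π : JointPolicy S Act)
    {f : S → ℝ} (hf : BddFun f) (h : ∀ s, 0 ≤ f s) :
    ρ.expect (G.resolvent π f) ≤ (1 - G.γ)⁻¹ * ((G.mismatch ρ).toReal * ρ.expect f) := by
  have e : G.resolvent π f = fun s => (1 - G.γ)⁻¹ * (G.occupancy π s).expect f := rfl
  rw [e, PMF.expect_const_mul, ← PMF.expect_bind _ _ hf]
  refine mul_le_mul_of_nonneg_left ?_ (inv_nonneg.2 one_sub_γ_pos.le)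
  rw [PMF.expect, PMF.expect, ← tsum_mul_left]
  refine (PMF.summable_expect _ hf).tsum_le_tsum (fun s => ?_)
    ((PMF.summable_expect _ hf).mul_left _)
  rw [← mul_assoc]
  exact mul_le_mul_of_nonneg_right (bind_occupancy_le hκ π s) (h s)

theorem one_le_mismatch {ρ : PMF S} (hκ : G.mismatch ρ ≠ ⊤) (π : JointPolicy S Act) :
    1 ≤ (G.mismatch ρ).toReal := by
  have h := (PMF.summable_toReal _).tsum_le_tsum (bind_occupancy_le hκ π)
    (ρ.summable_toReal.mul_left _)
  rwa [PMF.tsum_toReal, tsum_mul_left, PMF.tsum_toReal, mul_one] at h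

/-- The policy playing the action `b` in every state. -/
noncomputable def purePolicy {α : Type*} [Fintype α] (b : α) : Policy S α := by
  classical
  exact fun _ => ⟨Pi.single b 1, single_mem_stdSimplex ℝ b⟩

/-- The policy drawing actions uniformly in every state. -/
noncomputable def uniformPolicy (α : Type*) [Fintype α] [Nonempty α] : Policy S α :=
  fun _ => ⟨fun _ => (Fintype.card α : ℝ)⁻¹, fun _ => by positivity, by simp⟩

theorem jointProb_update (π : JointPolicy S Act) (i : Fin N) (p : Policy S (Act i)) (s : S)
    (a : ∀ j, Act j) :
    jointProb (Function.update π i p) s a =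
      (p s).1 (a i) * ∏ j ∈ Finset.univ.erase i, (π j s).1 (a j) := by
  rw [jointProb, ← Finset.mul_prod_erase _ _ (Finset.mem_univ i), Function.update_self]
  congr 1
  refine Finset.prod_congr rfl fun j hj => ?_
  rw [Function.update_of_ne (Finset.ne_of_mem_erase hj)]

/-- The joint action law is affine in each player's mixed action. This is the source of all the ℓ¹
bounds below. -/
theorem actionAvg_update (π : JointPolicy S Act) (i : Fin N) (p : Policy S (Act i))
    (F : S → (∀ i, Act i) → ℝ) (s : S) :
    actionAvg (Function.update π i p) F s =
      ∑ b, (p s).1 b * actionAvg (Function.update π i (purePolicy b)) F s := by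
  classical
  simp only [actionAvg, jointProb_update, Finset.mul_sum]
  rw [Finset.sum_comm]
  refine Finset.sum_congr rfl fun a _ => ?_
  rw [Finset.sum_eq_single (a i)]
  · simp [purePolicy]; ring
  · intro b _ hb
    simp [purePolicy, hb.symm]
  · simp

theorem QBar_eq (i : Fin N) (π : JointPolicy S Act) (s : S) (b : Act i) :
    G.QBar i π s b = actionAvg (Function.update π i (purePolicy b)) (G.Q i π) s := by
  classical
  rw [QBar, Finset.sum_filter, actionAvg]
  refine Finset.sum_congr rfl fun a _ => ?_
  rw [jointProb_update]
  by_cases h : a i = b <;> simp [purePolicy, h]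

theorem actionAvg_update_Q (i : Fin N) (π : JointPolicy S Act) (p : Policy S (Act i)) (s : S) :
    actionAvg (Function.update π i p) (G.Q i π) s = ∑ b, (p s).1 b * G.QBar i π s b := by
  simp only [QBar_eq]
  exact actionAvg_update π i p _ s

theorem expect_kernel_update (π : JointPolicy S Act) (i : Fin N) (p : Policy S (Act i)) (s : S)
    {f : S → ℝ} (hf : BddFun f) :
    (G.kernel (Function.update π i p) s).expect f =
      ∑ b, (p s).1 b * (G.kernel (Function.update π i (purePolicy b)) s).expect f := by
  simp only [expect_kernel _ _ _ hf]
  exact actionAvg_update π i p _ s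

section Distances

variable {α : Type*} [Fintype α]

/-- The `ℓ¹` distance between two policies at a state. -/
def l1Dist (p q : Policy S α) (s : S) : ℝ := ∑ b, |(p s).1 b - (q s).1 b|

/-- The squared Euclidean distance between two policies at a state. -/
def sqDist (p q : Policy S α) (s : S) : ℝ := ∑ b, ((p s).1 b - (q s).1 b) ^ 2

theorem l1Dist_nonneg (p q : Policy S α) (s : S) : 0 ≤ l1Dist p q s :=
  Finset.sum_nonneg fun _ _ => abs_nonneg _

theorem sqDist_nonneg (p q : Policy S α) (s : S) : 0 ≤ sqDist p q s :=
  Finset.sum_nonneg fun _ _ => sq_nonneg _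

theorem l1Dist_sq_le (p q : Policy S α) (s : S) :
    l1Dist p q s ^ 2 ≤ Fintype.card α * sqDist p q s := by
  have h := sq_sum_le_card_mul_sum_sq (s := Finset.univ) (f := fun b => |(p s).1 b - (q s).1 b|)
  simpa [l1Dist, sqDist] using h

theorem policy_mem_Icc (p : Policy S α) (s : S) (b : α) : (p s).1 b ∈ Set.Icc (0 : ℝ) 1 :=
  ⟨(p s).2.1 b, (Finset.single_le_sum (fun c _ => (p s).2.1 c) (Finset.mem_univ b)).trans_eq
    (p s).2.2⟩

theorem bddFun_policy_sub (p q : Policy S α) (b : α) :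
    BddFun fun s => (p s).1 b - (q s).1 b :=
  BddFun.sub (.of_mem_Icc fun s => policy_mem_Icc p s b) (.of_mem_Icc fun s => policy_mem_Icc q s b)

theorem bddFun_l1Dist (p q : Policy S α) : BddFun (l1Dist p q) :=
  .sum _ fun b _ => (bddFun_policy_sub p q b).abs

theorem bddFun_sqDist (p q : Policy S α) : BddFun (sqDist p q) :=
  .sum _ fun b _ => (bddFun_policy_sub p q b).pow 2

end Distances

theorem abs_sum_sub_mul_le {α : Type*} [Fintype α] (p q : Policy S α) (s : S) {f : α → ℝ} {B : ℝ}
    (h : ∀ b, |f b| ≤ B) :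
    |∑ b, (p s).1 b * f b - ∑ b, (q s).1 b * f b| ≤ l1Dist p q s * B := by
  rw [← Finset.sum_sub_distrib, l1Dist, Finset.sum_mul]
  refine (Finset.abs_sum_le_sum_abs _ _).trans (Finset.sum_le_sum fun b _ => ?_)
  rw [← sub_mul, abs_mul]
  exact mul_le_mul_of_nonneg_left (h b) (abs_nonneg _)

section UnilateralChange

variable (σ : JointPolicy S Act) {i j : Fin N} (p p' : Policy S (Act i))

theorem abs_actionAvg_update_sub_le {F : S → (∀ i, Act i) → ℝ} {B : ℝ}
    (h : ∀ s a, F s a ∈ Set.Icc 0 B) (s : S) :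
    |actionAvg (Function.update σ i p') F s - actionAvg (Function.update σ i p) F s| ≤
      l1Dist p' p s * B := by
  rw [actionAvg_update σ i p', actionAvg_update σ i p]
  refine abs_sum_sub_mul_le _ _ _ fun b => ?_
  have := actionAvg_mem_Icc (Function.update σ i (purePolicy b)) h s
  rw [abs_of_nonneg this.1]
  exact this.2

theorem abs_actionAvg_mixed_sub_le (hij : i ≠ j) (q q' : Policy S (Act j))
    {F : S → (∀ i, Act i) → ℝ} {B : ℝ} (h : ∀ s a, F s a ∈ Set.Icc 0 B) (s : S) :
    |actionAvg (Function.update (Function.update σ j q') i p') F s -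
        actionAvg (Function.update (Function.update σ j q') i p) F s -
        (actionAvg (Function.update (Function.update σ j q) i p') F s -
          actionAvg (Function.update (Function.update σ j q) i p) F s)| ≤
      l1Dist p' p s * (l1Dist q' q s * B) := by
  have e : ∀ r : Policy S (Act i),
      actionAvg (Function.update (Function.update σ j q') i r) F s -
        actionAvg (Function.update (Function.update σ j q) i r) F s =
      ∑ b, (r s).1 b *
        (actionAvg (Function.update (Function.update σ i (purePolicy b)) j q') F s -
          actionAvg (Function.update (Function.update σ i (purePolicy b)) j q) F s) := fun r => by
    rw [actionAvg_update _ i r, actionAvg_update _ i r, ← Finset.sum_sub_distrib]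
    refine Finset.sum_congr rfl fun b _ => ?_
    rw [Function.update_comm hij.symm, Function.update_comm hij.symm]
    ring
  have h1 := abs_sum_sub_mul_le p' p s fun b =>
    abs_actionAvg_update_sub_le (Function.update σ i (purePolicy b)) q q' h s
  rw [← e, ← e] at h1
  convert h1 using 2
  ring

variable (G) in
/-- Discounted expectation of `f` at the next state when player `i` draws an action with weights
`|p' - p|` and the other players follow `σ`. -/
noncomputable def deviationStep (f : S → ℝ) (s : S) : ℝ :=
  G.γ * ∑ b, |(p' s).1 b - (p s).1 b| *
    (G.kernel (Function.update σ i (purePolicy b)) s).expect f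

theorem bddFun_deviationStep {f : S → ℝ} (hf : BddFun f) :
    BddFun (G.deviationStep σ p p' f) :=
  .const_mul _ (.sum _ fun b _ => (bddFun_policy_sub p' p b).abs.mul (bddFun_kernel hf))

theorem deviationStep_nonneg {f : S → ℝ} (h : ∀ s, 0 ≤ f s) (s : S) :
    0 ≤ G.deviationStep σ p p' f s :=
  mul_nonneg G.γ_nonneg (Finset.sum_nonneg fun _ _ =>
    mul_nonneg (abs_nonneg _) (PMF.expect_nonneg _ h))

theorem abs_kernel_update_sub_le {f : S → ℝ} (hf : BddFun f) (s : S) :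
    |G.γ * ((G.kernel (Function.update σ i p') s).expect f -
        (G.kernel (Function.update σ i p) s).expect f)| ≤
      G.deviationStep σ p p' (fun s => |f s|) s := by
  rw [expect_kernel_update _ _ p' _ hf, expect_kernel_update _ _ p _ hf, ← Finset.sum_sub_distrib,
    abs_mul, abs_of_nonneg G.γ_nonneg, deviationStep]
  refine mul_le_mul_of_nonneg_left ((Finset.abs_sum_le_sum_abs _ _).trans
    (Finset.sum_le_sum fun b _ => ?_)) G.γ_nonneg
  rw [← sub_mul, abs_mul]
  exact mul_le_mul_of_nonneg_left (PMF.abs_expect_le_expect_abs _ hf) (abs_nonneg _)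

theorem deviationStep_le {f : S → ℝ} (hf : BddFun f) {U : ℝ} (h0 : ∀ s, 0 ≤ f s)
    (h : ∀ s, f s ≤ U) (s : S) : G.deviationStep σ p p' f s ≤ l1Dist p' p s * U := by
  have h1 : ∑ b, |(p' s).1 b - (p s).1 b| *
      (G.kernel (Function.update σ i (purePolicy b)) s).expect f ≤ l1Dist p' p s * U := by
    rw [l1Dist, Finset.sum_mul]
    exact Finset.sum_le_sum fun b _ =>
      mul_le_mul_of_nonneg_left (PMF.expect_le _ hf h) (abs_nonneg _)
  have h2 : 0 ≤ l1Dist p' p s * U :=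
    mul_nonneg (l1Dist_nonneg _ _ _) ((h0 s).trans (h s))
  calc _ ≤ G.γ * (l1Dist p' p s * U) := mul_le_mul_of_nonneg_left h1 G.γ_nonneg
    _ ≤ 1 * (l1Dist p' p s * U) := mul_le_mul_of_nonneg_right G.γ_lt_one.le h2
    _ = _ := one_mul _

/-- The weights |p' - p| are not a policy, so the change of measure does not apply to them. AM–GM
with parameter `c` separates them from the transition. The unweighted sum over actions that remains
is card times the kernel of the uniform policy, hence bounded by the occupancy of a genuine policy.
-/
theorem deviationStep_le_sq [Nonempty (Act i)] {f : S → ℝ} (hf : BddFun f) {c : ℝ} (hc : 0 < c)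
    (s : S) :
    G.deviationStep σ p p' f s ≤ 1 / 2 * (c * sqDist p' p s + c⁻¹ * (Fintype.card (Act i) *
      G.resolvent (Function.update σ i (uniformPolicy (Act i))) (fun s => f s ^ 2) s)) := by
  set k : Act i → ℝ := fun b => (G.kernel (Function.update σ i (purePolicy b)) s).expect f with hk
  have h1 : ∀ b, |(p' s).1 b - (p s).1 b| * k b ≤
      1 / 2 * (c * ((p' s).1 b - (p s).1 b) ^ 2 + c⁻¹ *
        (G.kernel (Function.update σ i (purePolicy b)) s).expect fun s => f s ^ 2) := fun b => by
    have hsq : k b ^ 2 ≤ (G.kernel (Function.update σ i (purePolicy b)) s).expect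
      fun s => f s ^ 2 := PMF.expect_sq_le _ hf
    have hy : |(p' s).1 b - (p s).1 b| * k b ≤
        1 / 2 * (c * |(p' s).1 b - (p s).1 b| ^ 2 + c⁻¹ * k b ^ 2) := by
      have := mul_nonneg (inv_nonneg.2 hc.le) (sq_nonneg (c * |(p' s).1 b - (p s).1 b| - k b))
      have e : c⁻¹ * (c * |(p' s).1 b - (p s).1 b| - k b) ^ 2 =
          c * |(p' s).1 b - (p s).1 b| ^ 2 - 2 * (|(p' s).1 b - (p s).1 b| * k b) +
            c⁻¹ * k b ^ 2 := by
        field_simp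
        ring
      linarith
    rw [sq_abs] at hy
    have := mul_le_mul_of_nonneg_left hsq (inv_nonneg.2 hc.le)
    linarith
  have hu := kernel_le_resolvent (G := G) (π := Function.update σ i (uniformPolicy (Act i)))
    (hf.pow 2) (fun s => sq_nonneg (f s)) s
  rw [expect_kernel_update _ _ _ _ (hf.pow 2)] at hu
  simp only [uniformPolicy, ← Finset.mul_sum] at hu
  have hA : (0 : ℝ) < Fintype.card (Act i) := by exact_mod_cast Fintype.card_pos
  have hu' : G.γ * ∑ b, (G.kernel (Function.update σ i (purePolicy b)) s).expect
      (fun s => f s ^ 2) ≤ Fintype.card (Act i) *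
        G.resolvent (Function.update σ i (uniformPolicy (Act i))) (fun s => f s ^ 2) s := by
    have := mul_le_mul_of_nonneg_left hu hA.le
    refine le_trans (le_of_eq ?_) this
    field_simp
  calc _ ≤ G.γ * ∑ b, 1 / 2 * (c * ((p' s).1 b - (p s).1 b) ^ 2 + c⁻¹ *
        (G.kernel (Function.update σ i (purePolicy b)) s).expect fun s => f s ^ 2) :=
        mul_le_mul_of_nonneg_left (Finset.sum_le_sum fun b _ => h1 b) G.γ_nonneg
    _ = 1 / 2 * (G.γ * (c * sqDist p' p s) + c⁻¹ * (G.γ *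
        ∑ b, (G.kernel (Function.update σ i (purePolicy b)) s).expect fun s => f s ^ 2)) := by
        rw [← Finset.mul_sum, Finset.sum_add_distrib, ← Finset.mul_sum, ← Finset.mul_sum, sqDist]
        ring
    _ ≤ _ := by
        have h2 := mul_le_mul_of_nonneg_left hu' (inv_nonneg.2 hc.le)
        have h3 := mul_le_mul_of_nonneg_right G.γ_lt_one.le
          (mul_nonneg hc.le (sqDist_nonneg p' p s))
        linarith

end UnilateralChange

/-- Subtract the Bellman equations of V_d - V_c and V_b - V_a. Replacing Q_a by Q_c costs γ(K_b -
K_a)(V_c - V_a), and replacing K_b by K_d on V_b - V_a costs the last term. When a, b, c, d are the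
corners of a square of two players' changes, each source term is of second order. -/
theorem mixed_V_sub_eq (k : Fin N) (a b c d : JointPolicy S Act) (s : S) :
    G.V k d s - G.V k c s - (G.V k b s - G.V k a s) = G.resolvent d (fun s =>
      (actionAvg d (G.Q k c) s - actionAvg c (G.Q k c) s -
        (actionAvg b (G.Q k c) s - actionAvg a (G.Q k c) s)) +
      G.γ * ((G.kernel b s).expect (fun s => G.V k c s - G.V k a s) -
        (G.kernel a s).expect (fun s => G.V k c s - G.V k a s)) +
      G.γ * ((G.kernel d s).expect (fun s => G.V k b s - G.V k a s) -
        (G.kernel b s).expect (fun s => G.V k b s - G.V k a s))) s := by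
  have hV : ∀ π, BddFun (G.V k π) := fun π => bddFun_V k
  have hQ := bddFun_actionAvg_Q (G := G) k
  refine eq_resolvent (X := fun s => G.V k d s - G.V k c s - (G.V k b s - G.V k a s))
    (((hV d).sub (hV c)).sub ((hV b).sub (hV a))) ?_ (fun s => ?_) s
  · exact ((((hQ c d).sub (hQ c c)).sub ((hQ c b).sub (hQ c a))).add
      (((bddFun_kernel ((hV c).sub (hV a))).sub (bddFun_kernel ((hV c).sub (hV a)))).const_mul
        _)).add
      (((bddFun_kernel ((hV b).sub (hV a))).sub (bddFun_kernel ((hV b).sub (hV a)))).const_mul _)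
  · have h1 := V_sub_V_bellman (G := G) k c d s
    have h2 := V_sub_V_bellman (G := G) k a b s
    rw [PMF.expect_sub _ ((hV d).sub (hV c)) ((hV b).sub (hV a)), h1, h2]
    simp only [PMF.expect_sub _ (hV _) (hV _), actionAvg_Q]
    ring

end MarkovGame

/-! ### Two bounds on mixed second differences -/

namespace MarkovGame

variable {N : ℕ} {S : Type*} {Act : Fin N → Type*} [∀ i, Fintype (Act i)]
  {G : MarkovGame N S Act}

section

variable (σ : JointPolicy S Act) {i j : Fin N} (p p' : Policy S (Act i)) (q q' : Policy S (Act j))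
  (k : Fin N)

theorem abs_V_update_sub_le (s : S) :
    |G.V k (Function.update σ i p') s - G.V k (Function.update σ i p) s| ≤
      G.resolvent (Function.update σ i p') (fun s => l1Dist p' p s * (1 - G.γ)⁻¹) s := by
  have hb := (bddFun_actionAvg_Q (G := G) k (Function.update σ i p) (Function.update σ i p')).sub
    (bddFun_actionAvg_Q (G := G) k (Function.update σ i p) (Function.update σ i p))
  rw [V_sub_V]
  refine (abs_resolvent_le hb s).trans
    (resolvent_mono hb.abs ((bddFun_l1Dist p' p).mul (.const _)) (fun s => ?_) s)
  exact abs_actionAvg_update_sub_le σ p p' (Q_mem_Icc k _) s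

theorem abs_mixed_V_sub_le (hij : i ≠ j) (s : S) :
    |G.V k (Function.update (Function.update σ j q') i p') s -
        G.V k (Function.update (Function.update σ j q') i p) s -
        (G.V k (Function.update (Function.update σ j q) i p') s -
          G.V k (Function.update (Function.update σ j q) i p) s)| ≤
      G.resolvent (Function.update (Function.update σ j q') i p') (fun s =>
        l1Dist p' p s * (l1Dist q' q s * (1 - G.γ)⁻¹) +
        G.deviationStep (Function.update σ j q) p p' (fun s =>
          |G.V k (Function.update (Function.update σ j q') i p) s -
            G.V k (Function.update (Function.update σ j q) i p) s|) s +
        G.deviationStep (Function.update σ i p') q q' (fun s =>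
          |G.V k (Function.update (Function.update σ j q) i p') s -
            G.V k (Function.update (Function.update σ j q) i p) s|) s) s := by
  have hV : ∀ π, BddFun (G.V k π) := fun π => bddFun_V k
  have hQ := bddFun_actionAvg_Q (G := G) k
  have hd : ∀ r, Function.update (Function.update σ j r) i p' =
      Function.update (Function.update σ i p') j r := fun r =>
    Function.update_comm hij.symm _ _ _
  rw [mixed_V_sub_eq]
  set a := Function.update (Function.update σ j q) i p
  set b := Function.update (Function.update σ j q) i p' with hb
  set c := Function.update (Function.update σ j q') i p
  set d := Function.update (Function.update σ j q') i p' with hd'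
  have hsrc := ((((hQ c d).sub (hQ c c)).sub ((hQ c b).sub (hQ c a))).add
      (((bddFun_kernel (G := G) (π := b) ((hV c).sub (hV a))).sub
        (bddFun_kernel (G := G) (π := a) ((hV c).sub (hV a)))).const_mul G.γ)).add
      (((bddFun_kernel (G := G) (π := d) ((hV b).sub (hV a))).sub
        (bddFun_kernel (G := G) (π := b) ((hV b).sub (hV a)))).const_mul G.γ)
  have hbd := (((bddFun_l1Dist p' p).mul ((bddFun_l1Dist q' q).mul (.const (1 - G.γ)⁻¹))).add
    (bddFun_deviationStep (G := G) (Function.update σ j q) p p' ((hV c).sub (hV a)).abs)).add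
    (bddFun_deviationStep (G := G) (Function.update σ i p') q q' ((hV b).sub (hV a)).abs)
  refine (abs_resolvent_le hsrc s).trans (resolvent_mono hsrc.abs hbd (fun s => ?_) s)
  refine (abs_add_le _ _).trans (add_le_add ((abs_add_le _ _).trans (add_le_add ?_ ?_)) ?_)
  · exact abs_actionAvg_mixed_sub_le σ p p' hij q q' (Q_mem_Icc k c) s
  · exact abs_kernel_update_sub_le (Function.update σ j q) p p' ((hV c).sub (hV a)) s
  · have := abs_kernel_update_sub_le (G := G) (Function.update σ i p') q q' ((hV b).sub (hV a)) s
    rwa [← hd, ← hd] at this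

variable {p p' q q'}

theorem abs_mixed_V_sub_le_of_l1Dist_le (hij : i ≠ j) {x y : ℝ} (hx : ∀ s, l1Dist p' p s ≤ x)
    (hy : ∀ s, l1Dist q' q s ≤ y) (s : S) :
    |G.V k (Function.update (Function.update σ j q') i p') s -
        G.V k (Function.update (Function.update σ j q') i p) s -
        (G.V k (Function.update (Function.update σ j q) i p') s -
          G.V k (Function.update (Function.update σ j q) i p) s)| ≤
      3 * (1 - G.γ)⁻¹ ^ 3 * (x * y) := by
  have hV : ∀ π, BddFun (G.V k π) := fun π => bddFun_V k
  have hg := one_le_inv_one_sub_γ (G := G)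
  have hx0 : 0 ≤ x := (l1Dist_nonneg _ _ s).trans (hx s)
  have hy0 : 0 ≤ y := (l1Dist_nonneg _ _ s).trans (hy s)
  set g := (1 - G.γ)⁻¹ with hgdef
  have hg0 : 0 ≤ g := zero_le_one.trans hg
  refine (abs_mixed_V_sub_le σ p p' q q' k hij s).trans ?_
  have hbd := (((bddFun_l1Dist p' p).mul ((bddFun_l1Dist q' q).mul (.const (1 - G.γ)⁻¹))).add
    (bddFun_deviationStep (G := G) (Function.update σ j q) p p'
      ((hV (Function.update (Function.update σ j q') i p)).sub
        (hV (Function.update (Function.update σ j q) i p))).abs)).add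
    (bddFun_deviationStep (G := G) (Function.update σ i p') q q'
      ((hV (Function.update (Function.update σ j q) i p')).sub
        (hV (Function.update (Function.update σ j q) i p))).abs)
  refine (resolvent_le (c := 3 * g ^ 2 * (x * y)) hbd (fun s => ?_) s).trans_eq (by
    rw [← hgdef]; ring)
  have hZ : ∀ s, |G.V k (Function.update (Function.update σ j q') i p) s -
      G.V k (Function.update (Function.update σ j q) i p) s| ≤ g * (y * g) := fun s => by
    rw [Function.update_comm hij.symm, Function.update_comm hij.symm]
    exact (abs_V_update_sub_le _ q q' k s).trans (resolvent_le
      ((bddFun_l1Dist q' q).mul (.const _)) (fun s => mul_le_mul_of_nonneg_right (hy s) hg0) s)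
  have hY : ∀ s, |G.V k (Function.update (Function.update σ j q) i p') s -
      G.V k (Function.update (Function.update σ j q) i p) s| ≤ g * (x * g) := fun s =>
    (abs_V_update_sub_le _ p p' k s).trans (resolvent_le
      ((bddFun_l1Dist p' p).mul (.const _)) (fun s => mul_le_mul_of_nonneg_right (hx s) hg0) s)
  have h1 : l1Dist p' p s * (l1Dist q' q s * g) ≤ x * (y * g) :=
    mul_le_mul (hx s) (mul_le_mul_of_nonneg_right (hy s) hg0)
      (mul_nonneg (l1Dist_nonneg _ _ s) hg0) hx0
  have h2 := (deviationStep_le (G := G) (Function.update σ j q) p p' ((hV _).sub (hV _)).abs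
    (fun s => abs_nonneg _) hZ s).trans (mul_le_mul_of_nonneg_right (hx s) (by positivity))
  have h3 := (deviationStep_le (G := G) (Function.update σ i p') q q' ((hV _).sub (hV _)).abs
    (fun s => abs_nonneg _) hY s).trans (mul_le_mul_of_nonneg_right (hy s) (by positivity))
  have h4 : x * (y * g) ≤ g ^ 2 * (x * y) := by
    have : x * y * g * 1 ≤ x * y * g * g := mul_le_mul_of_nonneg_left hg (by positivity)
    linarith
  refine (add_le_add (add_le_add h1 h2) h3).trans ?_
  linarith

variable {ρ : PMF S} {A : ℕ} [∀ i, Nonempty (Act i)]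

/-- Measure is changed three times, from the occupancies of `d`, of player `i` playing uniformly,
and of `τ`. After AM–GM, each of the two terms meets only two of them, whence κ². -/
theorem expect_resolvent_deviationStep_le (hA : ∀ i, Fintype.card (Act i) = A)
    (hκ : G.mismatch ρ ≠ ⊤) (d τ : JointPolicy S Act) {f : S → ℝ} (hf : BddFun f)
    (h0 : ∀ s, 0 ≤ f s)
    (h : ∀ s, f s ≤ G.resolvent τ (fun s => l1Dist q' q s * (1 - G.γ)⁻¹) s) :
    ρ.expect (G.resolvent d (G.deviationStep σ p p' f)) ≤
      1 / 2 * (A * (G.mismatch ρ).toReal ^ 2 * (1 - G.γ)⁻¹ ^ 4) *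
        (ρ.expect (sqDist p' p) + ρ.expect (sqDist q' q)) := by
  have hκ1 := one_le_mismatch hκ σ
  have hg := one_le_inv_one_sub_γ (G := G)
  have hA0 : (0 : ℝ) < A := by
    rw [← hA i]; exact_mod_cast Fintype.card_pos
  have hdb := bddFun_deviationStep (G := G) σ p p' hf
  have hl : BddFun fun s => l1Dist q' q s * (1 - G.γ)⁻¹ := (bddFun_l1Dist q' q).mul (.const _)
  have hb2 : BddFun (G.resolvent (Function.update σ i (uniformPolicy (Act i)))
      (fun s => f s ^ 2)) := bddFun_resolvent (hf.pow 2)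
  have h1 := expect_resolvent_le hκ d hdb (deviationStep_nonneg σ p p' h0)
  have hA' : (Fintype.card (Act i) : ℝ) = A := by exact_mod_cast hA i
  have hAj : (Fintype.card (Act j) : ℝ) = A := by exact_mod_cast hA j
  have h3 := expect_resolvent_le hκ (Function.update σ i (uniformPolicy (Act i))) (hf.pow 2)
    fun s => sq_nonneg (f s)
  have h4 : ρ.expect (fun s => f s ^ 2) ≤ (1 - G.γ)⁻¹ *
      ρ.expect (G.resolvent τ fun s => (l1Dist q' q s * (1 - G.γ)⁻¹) ^ 2) := by
    rw [← PMF.expect_const_mul]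
    exact PMF.expect_mono _ (hf.pow 2) ((bddFun_resolvent (hl.pow 2)).const_mul _) fun s =>
      (pow_le_pow_left₀ (h0 s) (h s) 2).trans (resolvent_sq_le hl s)
  have h5 := expect_resolvent_le hκ τ (hl.pow 2) fun s => sq_nonneg _
  have h6 : ρ.expect (fun s => (l1Dist q' q s * (1 - G.γ)⁻¹) ^ 2) ≤
      (1 - G.γ)⁻¹ ^ 2 * A * ρ.expect (sqDist q' q) := by
    rw [← PMF.expect_const_mul]
    refine PMF.expect_mono _ (hl.pow 2) ((bddFun_sqDist q' q).const_mul _) fun s => ?_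
    have := mul_le_mul_of_nonneg_left (l1Dist_sq_le q' q s) (sq_nonneg (1 - G.γ)⁻¹)
    rw [hAj] at this
    linarith
  set κ := (G.mismatch ρ).toReal
  set g := (1 - G.γ)⁻¹
  have hg0 : 0 < g := zero_lt_one.trans_le hg
  have hκ0 : 0 < κ := zero_lt_one.trans_le hκ1
  -- This AM–GM weight makes the two squared distances appear with equal coefficients, once the g⁵
  -- arising in `h7` is relaxed to g⁶.
  have hc : 0 < A * κ * g ^ 3 := by positivity
  have h2 : ρ.expect (G.deviationStep σ p p' f) ≤ 1 / 2 * (A * κ * g ^ 3 *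
      ρ.expect (sqDist p' p) + (A * κ * g ^ 3)⁻¹ * (A *
        ρ.expect (G.resolvent (Function.update σ i (uniformPolicy (Act i)))
          (fun s => f s ^ 2)))) := by
    rw [← PMF.expect_const_mul, ← PMF.expect_const_mul, ← PMF.expect_const_mul,
      ← PMF.expect_add _ ((bddFun_sqDist p' p).const_mul _) ((hb2.const_mul _).const_mul _),
      ← PMF.expect_const_mul]
    refine PMF.expect_mono _ hdb
      ((((bddFun_sqDist p' p).const_mul _).add ((hb2.const_mul _).const_mul _)).const_mul _)
      fun s => ?_
    have := deviationStep_le_sq (G := G) σ p p' hf hc s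
    rwa [hA'] at this
  have hE : 0 ≤ ρ.expect (sqDist q' q) := PMF.expect_nonneg _ (sqDist_nonneg q' q)
  have h7 : ρ.expect (G.resolvent (Function.update σ i (uniformPolicy (Act i)))
      (fun s => f s ^ 2)) ≤ A * κ ^ 2 * g ^ 6 * ρ.expect (sqDist q' q) := by
    calc _ ≤ g * (κ * (g * (g * (κ * (g ^ 2 * A * ρ.expect (sqDist q' q)))))) := by
          refine h3.trans ?_
          gcongr
          refine h4.trans ?_
          gcongr
          refine h5.trans ?_
          gcongr
      _ = A * κ ^ 2 * g ^ 5 * 1 * ρ.expect (sqDist q' q) := by ring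
      _ ≤ A * κ ^ 2 * g ^ 5 * g * ρ.expect (sqDist q' q) := by gcongr
      _ = _ := by ring
  calc _ ≤ g * (κ * (1 / 2 * (A * κ * g ^ 3 * ρ.expect (sqDist p' p) + (A * κ * g ^ 3)⁻¹ *
        (A * (A * κ ^ 2 * g ^ 6 * ρ.expect (sqDist q' q)))))) := by
        refine h1.trans ?_
        gcongr
        refine h2.trans ?_
        gcongr
    _ = _ := by
        field_simp

theorem abs_expect_mixed_V_sub_le (hij : i ≠ j) (hA : ∀ i, Fintype.card (Act i) = A)
    (hκ : G.mismatch ρ ≠ ⊤) :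
    |ρ.expect fun s => G.V k (Function.update (Function.update σ j q') i p') s -
        G.V k (Function.update (Function.update σ j q') i p) s -
        (G.V k (Function.update (Function.update σ j q) i p') s -
          G.V k (Function.update (Function.update σ j q) i p) s)| ≤
      3 / 2 * (A * (G.mismatch ρ).toReal ^ 3 * (1 - G.γ)⁻¹ ^ 4) *
        (ρ.expect (sqDist p' p) + ρ.expect (sqDist q' q)) := by
  have hV : ∀ π, BddFun (G.V k π) := fun π => bddFun_V k
  have hκ1 := one_le_mismatch hκ σ
  have hg := one_le_inv_one_sub_γ (G := G)
  have hA' : (Fintype.card (Act i) : ℝ) = A := by exact_mod_cast hA i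
  have hAj : (Fintype.card (Act j) : ℝ) = A := by exact_mod_cast hA j
  set a := Function.update (Function.update σ j q) i p with ha
  set b := Function.update (Function.update σ j q) i p'
  set c := Function.update (Function.update σ j q') i p with hc
  set d := Function.update (Function.update σ j q') i p'
  have b1 : BddFun fun s => l1Dist p' p s * (l1Dist q' q s * (1 - G.γ)⁻¹) :=
    (bddFun_l1Dist p' p).mul ((bddFun_l1Dist q' q).mul (.const _))
  have bZ : BddFun fun s => |G.V k c s - G.V k a s| := ((hV c).sub (hV a)).abs
  have bY : BddFun fun s => |G.V k b s - G.V k a s| := ((hV b).sub (hV a)).abs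
  have b2 := bddFun_deviationStep (G := G) (Function.update σ j q) p p' bZ
  have b3 := bddFun_deviationStep (G := G) (Function.update σ i p') q q' bY
  have hW := ((hV d).sub (hV c)).sub ((hV b).sub (hV a))
  have h1 := expect_resolvent_le hκ d b1 fun s => mul_nonneg (l1Dist_nonneg p' p s)
    (mul_nonneg (l1Dist_nonneg q' q s) (inv_nonneg.2 one_sub_γ_pos.le))
  have h2 := expect_resolvent_deviationStep_le (Function.update σ j q) (p := p) (p' := p')
    (q := q) (q' := q') hA hκ d c bZ (fun s => abs_nonneg _) fun s => by
      rw [ha, hc, Function.update_comm hij.symm, Function.update_comm hij.symm]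
      exact abs_V_update_sub_le _ q q' k s
  have h3 := expect_resolvent_deviationStep_le (Function.update σ i p') (p := q) (p' := q')
    (q := p) (q' := p') hA hκ d b bY (fun s => abs_nonneg _) fun s =>
      abs_V_update_sub_le _ p p' k s
  have h0 : |ρ.expect fun s => G.V k d s - G.V k c s - (G.V k b s - G.V k a s)| ≤
      ρ.expect (G.resolvent d fun s => l1Dist p' p s * (l1Dist q' q s * (1 - G.γ)⁻¹)) +
      ρ.expect (G.resolvent d (G.deviationStep (Function.update σ j q) p p' fun s =>
        |G.V k c s - G.V k a s|)) +
      ρ.expect (G.resolvent d (G.deviationStep (Function.update σ i p') q q' fun s =>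
        |G.V k b s - G.V k a s|)) := by
    have r1 := bddFun_resolvent (G := G) (π := d) b1
    have r2 := bddFun_resolvent (G := G) (π := d) b2
    have r3 := bddFun_resolvent (G := G) (π := d) b3
    rw [← PMF.expect_add _ r1 r2, ← PMF.expect_add _ (r1.add r2) r3]
    refine (PMF.abs_expect_le_expect_abs _ hW).trans
      (PMF.expect_mono _ hW.abs ((r1.add r2).add r3) fun s => ?_)
    refine (abs_mixed_V_sub_le σ p p' q q' k hij s).trans_eq ?_
    rw [resolvent_add (b1.add b2) b3, resolvent_add b1 b2]
  have h4 : ρ.expect (fun s => l1Dist p' p s * (l1Dist q' q s * (1 - G.γ)⁻¹)) ≤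
      1 / 2 * (A * (1 - G.γ)⁻¹) * (ρ.expect (sqDist p' p) + ρ.expect (sqDist q' q)) := by
    rw [← PMF.expect_add _ (bddFun_sqDist p' p) (bddFun_sqDist q' q), ← PMF.expect_const_mul]
    refine PMF.expect_mono _ b1
      (((bddFun_sqDist p' p).add (bddFun_sqDist q' q)).const_mul _) fun s => ?_
    have e1 := l1Dist_sq_le p' p s
    have e2 := l1Dist_sq_le q' q s
    rw [hA'] at e1
    rw [hAj] at e2
    have e3 : l1Dist p' p s * l1Dist q' q s ≤ 1 / 2 * (A * (sqDist p' p s + sqDist q' q s)) := by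
      nlinarith [sq_nonneg (l1Dist p' p s - l1Dist q' q s)]
    have := mul_le_mul_of_nonneg_right e3 (zero_le_one.trans hg)
    linarith
  set κ := (G.mismatch ρ).toReal
  set g := (1 - G.γ)⁻¹
  have hg0 : 0 < g := zero_lt_one.trans_le hg
  have hκ0 : 0 < κ := zero_lt_one.trans_le hκ1
  have hE := PMF.expect_nonneg ρ (sqDist_nonneg p' p)
  have hE' := PMF.expect_nonneg ρ (sqDist_nonneg q' q)
  set E := ρ.expect (sqDist p' p)
  set E' := ρ.expect (sqDist q' q)
  -- The three source terms carry κ, κ² and κ²; all are relaxed to κ³, the power in the second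
  -- stepsize.
  have h5 : g * (κ * (1 / 2 * (A * g) * (E + E'))) ≤ 1 / 2 * (A * κ ^ 3 * g ^ 4) * (E + E') := by
    have e1 : κ * 1 ≤ κ ^ 3 := by
      have := pow_le_pow_right₀ hκ1 (show 1 ≤ 3 by norm_num)
      linarith
    have e2 : g ^ 2 ≤ g ^ 4 := pow_le_pow_right₀ hg (by norm_num)
    calc _ = 1 / 2 * (A * (κ * 1) * g ^ 2) * (E + E') := by ring
      _ ≤ _ := by gcongr
  have h6 : 1 / 2 * (A * κ ^ 2 * g ^ 4) * (E + E') ≤ 1 / 2 * (A * κ ^ 3 * g ^ 4) * (E + E') := by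
    have e1 : κ ^ 2 ≤ κ ^ 3 := pow_le_pow_right₀ hκ1 (by norm_num)
    gcongr
  have h7 : g * (κ * ρ.expect fun s => l1Dist p' p s * (l1Dist q' q s * g)) ≤
      g * (κ * (1 / 2 * (A * g) * (E + E'))) := by gcongr
  rw [add_comm E' E] at h3
  linarith

end

end MarkovGame

/-! ### The proximal step on a convex set -/

section Proximal

variable {α : Type*} [Fintype α] {q p₀ p' p : α → ℝ} {η : ℝ}

/-- Variational inequality for a proximal step on a convex set. -/
theorem mul_sum_sub_mul_le_of_isMaxOn {s : Set (α → ℝ)} (hs : Convex ℝ s) (hη : 0 < η)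
    (hp' : p' ∈ s) (hp : p ∈ s)
    (h : IsMaxOn (fun p : α → ℝ => ∑ a, p a * q a - 1 / (2 * η) * ∑ a, (p a - p₀ a) ^ 2) s p') :
    η * ∑ a, (p a - p' a) * q a ≤ ∑ a, (p a - p' a) * (p' a - p₀ a) := by
  set D := ∑ a, (p a - p' a) ^ 2
  have hD : 0 ≤ D := Finset.sum_nonneg fun _ _ => sq_nonneg _
  -- Compare the maximizer with the point a fraction ε of the way to `p`, and divide by ε; only the
  -- quadratic term keeps a factor ε.
  have key : ∀ ε : ℝ, 0 < ε → ε ≤ 1 →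
      η * ∑ a, (p a - p' a) * q a - ∑ a, (p a - p' a) * (p' a - p₀ a) ≤ ε * D := by
    intro ε h0 h1
    have hx : p' + ε • (p - p') ∈ s := hs.add_smul_sub_mem hp' hp ⟨h0.le, h1⟩
    have hmax := h hx
    simp only [Set.mem_ofPred_eq, Pi.add_apply, Pi.smul_apply, Pi.sub_apply, smul_eq_mul] at hmax
    have e1 : ∑ a, (p' a + ε * (p a - p' a)) * q a =
        ∑ a, p' a * q a + ε * ∑ a, (p a - p' a) * q a := by
      rw [Finset.mul_sum, ← Finset.sum_add_distrib]
      exact Finset.sum_congr rfl fun a _ => by ring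
    have e2 : ∑ a, (p' a + ε * (p a - p' a) - p₀ a) ^ 2 =
        ∑ a, (p' a - p₀ a) ^ 2 + 2 * ε * ∑ a, (p a - p' a) * (p' a - p₀ a) + ε ^ 2 * D := by
      rw [Finset.mul_sum, Finset.mul_sum, ← Finset.sum_add_distrib, ← Finset.sum_add_distrib]
      exact Finset.sum_congr rfl fun a _ => by ring
    rw [e1, e2] at hmax
    have h2 : ε * ∑ a, (p a - p' a) * q a ≤ 1 / (2 * η) *
        (2 * ε * ∑ a, (p a - p' a) * (p' a - p₀ a) + ε ^ 2 * D) := by linarith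
    have h3 := mul_le_mul_of_nonneg_left h2 (by positivity : 0 ≤ η / ε)
    have e3 : η / ε * (ε * ∑ a, (p a - p' a) * q a) = η * ∑ a, (p a - p' a) * q a := by
      field_simp
    have e4 : η / ε * (1 / (2 * η) *
        (2 * ε * ∑ a, (p a - p' a) * (p' a - p₀ a) + ε ^ 2 * D)) =
        ∑ a, (p a - p' a) * (p' a - p₀ a) + ε * D / 2 := by
      field_simp
    rw [e3, e4] at h3
    nlinarith
  by_contra hcon
  rw [not_le, ← sub_pos] at hcon
  set x := η * ∑ a, (p a - p' a) * q a - ∑ a, (p a - p' a) * (p' a - p₀ a)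
  -- This ε gives x ≤ εD ≤ x/2, impossible for x > 0; the `D + 1` avoids division by zero.
  have h1 := key (min 1 (x / (2 * (D + 1)))) (lt_min one_pos (by positivity)) (min_le_left _ _)
  have h2 : min 1 (x / (2 * (D + 1))) * D ≤ x / (2 * (D + 1)) * D :=
    mul_le_mul_of_nonneg_right (min_le_right _ _) hD
  have h3 : x / (2 * (D + 1)) * D ≤ x / 2 := by
    rw [div_mul_eq_mul_div, div_le_div_iff₀ (by positivity) (by norm_num)]
    nlinarith
  linarith

end Proximal

/-! ### One gradient step: gain, size and remaining regret -/

namespace MarkovGame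

section PolicyStep

variable {S α : Type*} [Fintype α] {q : α → ℝ} {p₀ p' : Policy S α} {s : S} {η g : ℝ}

theorem sqDist_le_of_isMaxOn (hη : 0 < η)
    (h : IsMaxOn (fun p : α → ℝ => ∑ a, p a * q a - 1 / (2 * η) * ∑ a, (p a - (p₀ s).1 a) ^ 2)
      (stdSimplex ℝ α) (p' s).1) :
    sqDist p' p₀ s ≤ η * (∑ a, (p' s).1 a * q a - ∑ a, (p₀ s).1 a * q a) := by
  have := mul_sum_sub_mul_le_of_isMaxOn (convex_stdSimplex ℝ α) hη (p' s).2 (p₀ s).2 h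
  have e1 : ∑ a, ((p₀ s).1 a - (p' s).1 a) * q a =
      -(∑ a, (p' s).1 a * q a - ∑ a, (p₀ s).1 a * q a) := by
    simp only [sub_mul, Finset.sum_sub_distrib]; ring
  have e2 : ∑ a, ((p₀ s).1 a - (p' s).1 a) * ((p' s).1 a - (p₀ s).1 a) = -sqDist p' p₀ s := by
    rw [sqDist, ← Finset.sum_neg_distrib]
    exact Finset.sum_congr rfl fun a _ => by ring
  rw [e1, e2] at this
  linarith

/-- The squared ℓ¹ distance is at most card times the squared Euclidean one, which is at most η g
times the ℓ¹ distance; divide by the latter. -/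
theorem l1Dist_le_of_isMaxOn (hη : 0 < η) (hq : ∀ a, |q a| ≤ g)
    (h : IsMaxOn (fun p : α → ℝ => ∑ a, p a * q a - 1 / (2 * η) * ∑ a, (p a - (p₀ s).1 a) ^ 2)
      (stdSimplex ℝ α) (p' s).1) :
    l1Dist p' p₀ s ≤ η * Fintype.card α * g := by
  have h1 := sqDist_le_of_isMaxOn hη h
  have h2 := (le_abs_self _).trans (abs_sum_sub_mul_le p' p₀ s hq)
  have h3 := l1Dist_sq_le p' p₀ s
  have h0 := l1Dist_nonneg p' p₀ s
  rcases h0.eq_or_lt with h0 | h0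
  -- Only `0 ≤ g` is needed here; it comes from any action, and one exists since the simplex is
  -- inhabited.
  · rw [← h0]
    obtain ⟨a, -, -⟩ := Finset.exists_ne_zero_of_sum_ne_zero
      ((p' s).2.2.trans_ne (one_ne_zero (α := ℝ)))
    have := (abs_nonneg _).trans (hq a)
    positivity
  · have h4 : sqDist p' p₀ s ≤ η * (l1Dist p' p₀ s * g) :=
      h1.trans (mul_le_mul_of_nonneg_left h2 hη.le)
    have h5 := mul_le_mul_of_nonneg_left h4 (Nat.cast_nonneg (α := ℝ) (Fintype.card α))
    refine le_of_mul_le_mul_right ?_ h0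
    linarith

/-- Split p - p₀ at p'. The variational inequality bounds the gain from p' to p by ⟨p - p', p' -
p₀⟩/η, and the gain from p₀ to p' is at most g times the ℓ¹ step. AM–GM is applied to both. -/
theorem sum_sub_mul_le_of_isMaxOn [Nonempty α] (hη : 0 < η) (hq : ∀ a, |q a| ≤ g)
    (h : IsMaxOn (fun p : α → ℝ => ∑ a, p a * q a - 1 / (2 * η) * ∑ a, (p a - (p₀ s).1 a) ^ 2)
      (stdSimplex ℝ α) (p' s).1) (hηg : Fintype.card α * (η * g) ^ 2 ≤ 1) (p : Policy S α)
    {c : ℝ} (hc : 0 < c) :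
    ∑ a, (p s).1 a * q a - ∑ a, (p₀ s).1 a * q a ≤
      (2 * η)⁻¹ * (2 * c * sqDist p' p₀ s + 3 / c) := by
  have h1 := mul_sum_sub_mul_le_of_isMaxOn (convex_stdSimplex ℝ α) hη (p' s).2 (p s).2 h
  have h2 := (le_abs_self _).trans (abs_sum_sub_mul_le p' p₀ s hq)
  have h3 := l1Dist_sq_le p' p₀ s
  have hA : (0 : ℝ) < Fintype.card α := by exact_mod_cast Fintype.card_pos
  -- Since (x - y)² ≤ x + y on [0,1], two points of the simplex are at squared distance at most 2,
  -- whatever the number of actions.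
  have h4 : ∑ a, ((p s).1 a - (p' s).1 a) * ((p' s).1 a - (p₀ s).1 a) ≤
      c / 2 * sqDist p' p₀ s + 1 / c := by
    have e : ∀ a, ((p s).1 a - (p' s).1 a) * ((p' s).1 a - (p₀ s).1 a) ≤
        c / 2 * ((p' s).1 a - (p₀ s).1 a) ^ 2 + 1 / (2 * c) * ((p s).1 a + (p' s).1 a) := by
      intro a
      obtain ⟨x0, x1⟩ := policy_mem_Icc p s a
      obtain ⟨y0, y1⟩ := policy_mem_Icc p' s a
      set x := (p s).1 a
      set y := (p' s).1 a
      set z := y - (p₀ s).1 a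
      have i1 : (x - y) ^ 2 ≤ x + y := by nlinarith
      have i2 : (x - y) * z ≤ c / 2 * z ^ 2 + 1 / (2 * c) * (x - y) ^ 2 := by
        have : c / 2 * z ^ 2 + 1 / (2 * c) * (x - y) ^ 2 - (x - y) * z =
            1 / (2 * c) * (c * z - (x - y)) ^ 2 := by
          field_simp
          ring
        have i3 : 0 ≤ 1 / (2 * c) * (c * z - (x - y)) ^ 2 := by positivity
        linarith
      have i4 := mul_le_mul_of_nonneg_left i1 (by positivity : 0 ≤ 1 / (2 * c))
      linarith
    refine (Finset.sum_le_sum fun a _ => e a).trans_eq ?_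
    rw [Finset.sum_add_distrib, ← Finset.mul_sum, ← Finset.mul_sum, Finset.sum_add_distrib,
      (p s).2.2, (p' s).2.2, sqDist]
    field_simp
    norm_num
  have h5 : η * (l1Dist p' p₀ s * g) ≤ c / 2 * sqDist p' p₀ s + 1 / (2 * c) := by
    have i1 : l1Dist p' p₀ s ^ 2 / Fintype.card α ≤ sqDist p' p₀ s := by
      rw [div_le_iff₀ hA]; linarith
    have i2 : c / 2 * (l1Dist p' p₀ s ^ 2 / Fintype.card α) +
        1 / (2 * c) * (Fintype.card α * (η * g) ^ 2) - η * (l1Dist p' p₀ s * g) =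
        1 / (2 * c * Fintype.card α) * (c * l1Dist p' p₀ s - Fintype.card α * (η * g)) ^ 2 := by
      field_simp
      ring
    have i3 : 0 ≤ 1 / (2 * c * Fintype.card α) *
        (c * l1Dist p' p₀ s - Fintype.card α * (η * g)) ^ 2 := by positivity
    have i4 := mul_le_mul_of_nonneg_left hηg (by positivity : 0 ≤ 1 / (2 * c))
    have i5 := mul_le_mul_of_nonneg_left i1 (by positivity : 0 ≤ c / 2)
    linarith
  have e1 : ∑ a, ((p s).1 a - (p' s).1 a) * q a =
      ∑ a, (p s).1 a * q a - ∑ a, (p' s).1 a * q a := by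
    simp only [sub_mul, Finset.sum_sub_distrib]
  rw [e1] at h1
  have h6 := mul_le_mul_of_nonneg_left h2 hη.le
  have h7 : 1 / (2 * c) = 1 / c / 2 := by field_simp
  have h8 : 3 / c = 3 * (1 / c) := by field_simp
  rw [inv_mul_eq_div, le_div_iff₀ (by positivity)]
  linarith

end PolicyStep

variable {N : ℕ} {S : Type*} {Act : Fin N → Type*} [∀ i, Fintype (Act i)]
  {G : MarkovGame N S Act} {π π' : JointPolicy S Act} {η : ℝ} {ρ : PMF S}

variable (G) in
/-- `π'` results from one step of independent projected policy gradient ascent at `π`. -/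
def IsGradientStep (η : ℝ) (π π' : JointPolicy S Act) : Prop :=
  ∀ i s, IsMaxOn
    (fun p : Act i → ℝ =>
      ∑ a, p a * G.QBar i π s a - 1 / (2 * η) * ∑ a, (p a - (π i s).1 a) ^ 2)
    (stdSimplex ℝ (Act i)) (π' i s).1

theorem abs_QBar_le (i : Fin N) (π : JointPolicy S Act) (s : S) (b : Act i) :
    |G.QBar i π s b| ≤ (1 - G.γ)⁻¹ := by
  rw [QBar_eq]
  have := actionAvg_mem_Icc (Function.update π i (purePolicy b)) (Q_mem_Icc (G := G) i π) s
  rw [abs_of_nonneg this.1]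
  exact this.2

theorem V_update_sub_V (i : Fin N) (π : JointPolicy S Act) (p : Policy S (Act i)) (s : S) :
    G.V i (Function.update π i p) s - G.V i π s = G.resolvent (Function.update π i p) (fun s =>
      ∑ b, (p s).1 b * G.QBar i π s b - ∑ b, (π i s).1 b * G.QBar i π s b) s := by
  rw [V_sub_V]
  congr 1
  funext s
  rw [← actionAvg_update_Q, ← actionAvg_update_Q, Function.update_eq_self]

theorem bddFun_advantage (i : Fin N) (π : JointPolicy S Act) (p : Policy S (Act i)) :
    BddFun fun s => ∑ b, (p s).1 b * G.QBar i π s b - ∑ b, (π i s).1 b * G.QBar i π s b :=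
  ((bddFun_l1Dist p (π i)).mul (.const (1 - G.γ)⁻¹)).of_abs_le fun s =>
    abs_sum_sub_mul_le p (π i) s (abs_QBar_le i π s)

namespace IsGradientStep

theorem l1Dist_le (h : G.IsGradientStep η π π') (hη : 0 < η) (i : Fin N) (s : S) :
    l1Dist (π' i) (π i) s ≤ η * Fintype.card (Act i) * (1 - G.γ)⁻¹ :=
  l1Dist_le_of_isMaxOn hη (abs_QBar_le i π s) (h i s)

/-- The step has nonnegative advantage at every state, so its discounted sum dominates its time-zero
term; no change of measure is spent. -/
theorem sqDist_le_V_sub (h : G.IsGradientStep η π π') (hη : 0 < η) (i : Fin N) (s : S) :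
    η⁻¹ * sqDist (π' i) (π i) s ≤ G.V i (Function.update π i (π' i)) s - G.V i π s := by
  have h1 : ∀ s, η⁻¹ * sqDist (π' i) (π i) s ≤
      ∑ b, (π' i s).1 b * G.QBar i π s b - ∑ b, (π i s).1 b * G.QBar i π s b := fun s => by
    rw [inv_mul_le_iff₀ hη]
    exact sqDist_le_of_isMaxOn hη (h i s)
  rw [V_update_sub_V]
  exact (h1 s).trans (le_resolvent (bddFun_advantage i π (π' i)) (fun s =>
    (mul_nonneg (inv_nonneg.2 hη.le) (sqDist_nonneg _ _ s)).trans (h1 s)) s)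

/-- Only the squared distance pays κ; the constant 3/c integrates exactly against any occupancy.
Balancing `c` later leaves κ under a square root. -/
theorem expect_V_update_sub_le [∀ i, Nonempty (Act i)] (h : G.IsGradientStep η π π')
    (hη : 0 < η) (hκ : G.mismatch ρ ≠ ⊤) (i : Fin N)
    (hηg : Fintype.card (Act i) * (η * (1 - G.γ)⁻¹) ^ 2 ≤ 1) (p : Policy S (Act i)) {c : ℝ}
    (hc : 0 < c) :
    G.VDist i (Function.update π i p) ρ - G.VDist i π ρ ≤ (1 - G.γ)⁻¹ * (2 * η)⁻¹ *
      (2 * c * ((G.mismatch ρ).toReal * ρ.expect (sqDist (π' i) (π i))) + 3 / c) := by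
  have e : G.VDist i (Function.update π i p) ρ - G.VDist i π ρ =
      ρ.expect fun s => G.V i (Function.update π i p) s - G.V i π s :=
    (PMF.expect_sub _ (bddFun_V i) (bddFun_V i)).symm
  have hsq := bddFun_sqDist (π' i) (π i)
  have h0 : 0 ≤ (2 * η)⁻¹ * (2 * c) := by positivity
  have b1 : BddFun fun s => (2 * η)⁻¹ * (2 * c) * sqDist (π' i) (π i) s := hsq.const_mul _
  have h1 := expect_resolvent_le hκ (Function.update π i p) b1
    fun s => mul_nonneg h0 (sqDist_nonneg _ _ s)
  rw [PMF.expect_const_mul] at h1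
  have h2 : ρ.expect (fun s => G.V i (Function.update π i p) s - G.V i π s) ≤
      ρ.expect (G.resolvent (Function.update π i p)
        fun s => (2 * η)⁻¹ * (2 * c) * sqDist (π' i) (π i) s) +
      (1 - G.γ)⁻¹ * ((2 * η)⁻¹ * (3 / c)) := by
    rw [← PMF.expect_const ρ ((1 - G.γ)⁻¹ * ((2 * η)⁻¹ * (3 / c))),
      ← PMF.expect_add _ (bddFun_resolvent b1) (.const _)]
    refine PMF.expect_mono _ ((bddFun_V i).sub (bddFun_V i))
      ((bddFun_resolvent b1).add (.const _)) fun s => ?_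
    rw [V_update_sub_V, ← resolvent_const (π := Function.update π i p) ((2 * η)⁻¹ * (3 / c)) s,
      ← resolvent_add b1 (.const _)]
    refine resolvent_mono (bddFun_advantage i π p) (b1.add (.const _)) (fun s => ?_) s
    refine (sum_sub_mul_le_of_isMaxOn hη (abs_QBar_le i π s) (h i s) hηg p hc).trans_eq ?_
    ring
  rw [e]
  linarith

end IsGradientStep

/-! ### Increase of the potential under simultaneous moves -/

/-- The joint policy in which the first `n` players follow `π'` and the others follow `π`. -/
def hybrid (π π' : JointPolicy S Act) (n : ℕ) : JointPolicy S Act :=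
  fun l => if l.val < n then π' l else π l

theorem hybrid_zero (π π' : JointPolicy S Act) : hybrid π π' 0 = π := by
  funext l; simp [hybrid]

theorem hybrid_last (π π' : JointPolicy S Act) : hybrid π π' N = π' := by
  funext l; simp [hybrid]

theorem hybrid_succ (π π' : JointPolicy S Act) (i : Fin N) :
    hybrid π π' (i + 1) = Function.update (hybrid π π' i) i (π' i) := by
  funext l
  rcases eq_or_ne l i with rfl | h
  · simp [hybrid]
  · have h' : l.val ≠ i.val := fun e => h (Fin.ext e)
    have : l.val < i.val + 1 ↔ l.val < i.val := by omega
    simp [hybrid, Function.update_of_ne h, this]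

theorem update_hybrid_self (π π' : JointPolicy S Act) (i : Fin N) :
    Function.update (hybrid π π' i) i (π i) = hybrid π π' i := by
  have : hybrid π π' i i = π i := by simp [hybrid]
  rw [← this, Function.update_eq_self]

theorem abs_sub_le_sum_fin (x : ℕ → ℝ) {b : Fin N → ℝ} (hb : ∀ j, 0 ≤ b j) {m : ℕ} (hm : m ≤ N)
    (h : ∀ j : Fin N, j.val < m → |x (j + 1) - x j| ≤ b j) : |x m - x 0| ≤ ∑ j, b j := by
  calc |x m - x 0| ≤ ∑ n ∈ Finset.range m, |x (n + 1) - x n| := by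
        rw [← Finset.sum_range_sub]
        exact Finset.abs_sum_le_sum_abs _ _
    _ = ∑ n ∈ Finset.range m, if n < m then |x (n + 1) - x n| else 0 :=
        Finset.sum_congr rfl fun n hn => by rw [if_pos (Finset.mem_range.1 hn)]
    _ ≤ ∑ n ∈ Finset.range N, if n < m then |x (n + 1) - x n| else 0 :=
        Finset.sum_le_sum_of_subset_of_nonneg (Finset.range_mono hm) fun n _ _ => by
          split_ifs <;> positivity
    _ = ∑ j : Fin N, if j.val < m then |x (j + 1) - x j| else 0 :=
        (Fin.sum_univ_eq_sum_range (fun n => if n < m then |x (n + 1) - x n| else 0) N).symm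
    _ ≤ ∑ j, b j := Finset.sum_le_sum fun j _ => by
        split_ifs with hj
        · exact h j hj
        · exact hb j

variable {Φ : JointPolicy S Act → S → ℝ}

theorem IsPotential.sub_eq_sum (hΦ : G.IsPotential Φ) (π π' : JointPolicy S Act) (s : S) :
    Φ π' s - Φ π s = ∑ i, (G.V i (Function.update (hybrid π π' i) i (π' i)) s -
      G.V i (Function.update (hybrid π π' i) i (π i)) s) := by
  have h := Finset.sum_range_sub (fun n => Φ (hybrid π π' n) s) N
  simp only [hybrid_zero, hybrid_last] at h
  rw [← h, ← Fin.sum_univ_eq_sum_range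
    (fun n => Φ (hybrid π π' (n + 1)) s - Φ (hybrid π π' n) s)]
  refine Finset.sum_congr rfl fun i _ => ?_
  rw [hΦ, update_hybrid_self, hybrid_succ]

/-- The potential may be unbounded in the state, but its differences are finite sums of value
differences, so their expectations make sense. -/
theorem IsPotential.bddFun_sub (hΦ : G.IsPotential Φ) (π π' : JointPolicy S Act) :
    BddFun fun s => Φ π' s - Φ π s := by
  simp only [hΦ.sub_eq_sum]
  exact .sum _ fun i _ => (bddFun_V i).sub (bddFun_V i)

/-- Lower bound on the increase of the potential in a gradient step from bounds on the mixed
second differences of the value functions. -/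
theorem IsPotential.le_expect_sub (hΦ : G.IsPotential Φ) (h : G.IsGradientStep η π π')
    (hη : 0 < η) {b : Fin N → Fin N → ℝ} (hb0 : ∀ i j, 0 ≤ b i j)
    (hb : ∀ (i j : Fin N) (σ : JointPolicy S Act), i ≠ j →
      |ρ.expect fun s => G.V i (Function.update (Function.update σ j (π' j)) i (π' i)) s -
        G.V i (Function.update (Function.update σ j (π' j)) i (π i)) s -
        (G.V i (Function.update (Function.update σ j (π j)) i (π' i)) s -
          G.V i (Function.update (Function.update σ j (π j)) i (π i)) s)| ≤ b i j) :
    η⁻¹ * ∑ i, ρ.expect (sqDist (π' i) (π i)) - ∑ i, ∑ j, b i j ≤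
      ρ.expect fun s => Φ π' s - Φ π s := by
  have hV : ∀ i π, BddFun (G.V i π) := fun i π => bddFun_V i
  simp only [hΦ.sub_eq_sum]
  rw [PMF.expect_sum _ _ fun i _ => (hV i _).sub (hV i _), Finset.mul_sum,
    ← Finset.sum_sub_distrib]
  refine Finset.sum_le_sum fun i _ => ?_
  let x : ℕ → ℝ := fun n => ρ.expect fun s =>
    G.V i (Function.update (hybrid π π' n) i (π' i)) s -
      G.V i (Function.update (hybrid π π' n) i (π i)) s
  -- Player i's gain is moved from the stage where players before i have switched back to the stage
  -- where nobody has; each intermediate stage costs one mixed difference.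
  have h1 : |x i - x 0| ≤ ∑ j, b i j := by
    refine abs_sub_le_sum_fin x (hb0 i) i.2.le fun j hj => ?_
    have hij : i ≠ j := fun e => by rw [e] at hj; exact hj.ne rfl
    have := hb i j (hybrid π π' j) hij
    rw [PMF.expect_sub _ ((hV i _).sub (hV i _)) ((hV i _).sub (hV i _)), ← hybrid_succ,
      update_hybrid_self] at this
    exact this
  have h2 : η⁻¹ * ρ.expect (sqDist (π' i) (π i)) ≤ x 0 := by
    rw [← PMF.expect_const_mul]
    refine PMF.expect_mono _ ((bddFun_sqDist _ _).const_mul _) ((hV i _).sub (hV i _)) fun s => ?_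
    rw [hybrid_zero, Function.update_eq_self]
    exact h.sqDist_le_V_sub hη i s
  have h3 := (abs_le.1 h1).1
  change _ ≤ x i
  linarith

theorem IsPotential.le_expect_sub_of_uniform {A : ℕ} (hA : ∀ i, Fintype.card (Act i) = A)
    (hΦ : G.IsPotential Φ) (h : G.IsGradientStep η π π') (hη : 0 < η) :
    η⁻¹ * ∑ i, ρ.expect (sqDist (π' i) (π i)) - 3 * (N * A * η) ^ 2 * (1 - G.γ)⁻¹ ^ 5 ≤
      ρ.expect fun s => Φ π' s - Φ π s := by
  have hV : ∀ i π, BddFun (G.V i π) := fun i π => bddFun_V i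
  have hg := inv_nonneg.2 (one_sub_γ_pos (G := G)).le
  have hl : ∀ i s, l1Dist (π' i) (π i) s ≤ η * A * (1 - G.γ)⁻¹ := fun i s => by
    have := h.l1Dist_le hη i s
    rwa [hA i] at this
  have := hΦ.le_expect_sub (ρ := ρ) h hη
    (b := fun _ _ => 3 * (1 - G.γ)⁻¹ ^ 3 * (η * A * (1 - G.γ)⁻¹ * (η * A * (1 - G.γ)⁻¹)))
    (fun _ _ => by positivity) fun i j σ hij =>
      PMF.abs_expect_le _ (((hV i _).sub (hV i _)).sub ((hV i _).sub (hV i _)))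
        (abs_mixed_V_sub_le_of_l1Dist_le σ i hij (hl i) (hl j))
  refine le_trans (le_of_eq ?_) this
  simp only [Finset.sum_const, Finset.card_univ, Fintype.card_fin, nsmul_eq_mul]
  ring

theorem IsPotential.le_expect_sub_of_mismatch [∀ i, Nonempty (Act i)] {A : ℕ}
    (hA : ∀ i, Fintype.card (Act i) = A) (hκ : G.mismatch ρ ≠ ⊤) (hΦ : G.IsPotential Φ)
    (h : G.IsGradientStep η π π') (hη : 0 < η) :
    (η⁻¹ - 3 * (N * A * (G.mismatch ρ).toReal ^ 3 * (1 - G.γ)⁻¹ ^ 4)) *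
        ∑ i, ρ.expect (sqDist (π' i) (π i)) ≤ ρ.expect fun s => Φ π' s - Φ π s := by
  have hg := inv_nonneg.2 (one_sub_γ_pos (G := G)).le
  have := hΦ.le_expect_sub (ρ := ρ) h hη
    (b := fun i j => 3 / 2 * (A * (G.mismatch ρ).toReal ^ 3 * (1 - G.γ)⁻¹ ^ 4) *
      (ρ.expect (sqDist (π' i) (π i)) + ρ.expect (sqDist (π' j) (π j))))
    (fun i j => mul_nonneg (by positivity)
      (add_nonneg (PMF.expect_nonneg _ (sqDist_nonneg _ _))
        (PMF.expect_nonneg _ (sqDist_nonneg _ _))))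
    fun i j σ hij => abs_expect_mixed_V_sub_le σ i hij hA hκ
  refine le_trans (le_of_eq ?_) this
  simp only [← Finset.mul_sum, Finset.sum_add_distrib, Finset.sum_const, Finset.card_univ,
    Fintype.card_fin, nsmul_eq_mul]
  ring

end MarkovGame

/-! ### Summation over the run and the two stepsizes -/

namespace MarkovGame

variable {N : ℕ} {S : Type*} {Act : Fin N → Type*} [∀ i, Fintype (Act i)]
  {G : MarkovGame N S Act} {Φ : JointPolicy S Act → S → ℝ} {Φmax η : ℝ} {ρ : PMF S} {T : ℕ}
  {π : ℕ → JointPolicy S Act}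

theorem VDist_mem_Icc (i : Fin N) (π : JointPolicy S Act) (ρ : PMF S) :
    G.VDist i π ρ ∈ Set.Icc 0 (1 - G.γ)⁻¹ :=
  ⟨PMF.expect_nonneg ρ fun s => (V_mem_Icc i π s).1,
    PMF.expect_le ρ (bddFun_V i) fun s => (V_mem_Icc i π s).2⟩

theorem nashRegret_le [∀ i, Nonempty (Act i)] [Nonempty (Fin N)] (hT : 1 ≤ T) (b : ℕ → ℝ)
    (h : ∀ t ∈ Finset.Icc 1 T, ∀ i p,
      G.VDist i (Function.update (π t) i p) ρ - G.VDist i (π t) ρ ≤ b t) :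
    G.nashRegret ρ T π ≤ 1 / (T : ℝ) * ∑ t ∈ Finset.Icc 1 T, b t := by
  refine mul_le_mul_of_nonneg_left (Finset.sum_le_sum fun t ht => ciSup_le fun i => ?_)
    (by positivity)
  have : Nonempty (Policy S (Act i)) := ⟨uniformPolicy (Act i)⟩
  rw [sub_le_iff_le_add]
  exact ciSup_le fun p => sub_le_iff_le_add.1 (h t ht i p)

theorem nashRegret_le_inv [∀ i, Nonempty (Act i)] [Nonempty (Fin N)] (hT : 1 ≤ T) :
    G.nashRegret ρ T π ≤ (1 - G.γ)⁻¹ := by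
  refine (nashRegret_le hT (fun _ => (1 - G.γ)⁻¹) fun t _ i p => ?_).trans_eq ?_
  · linarith [(VDist_mem_Icc (G := G) i (Function.update (π t) i p) ρ).2,
      (VDist_mem_Icc (G := G) i (π t) ρ).1]
  · have : (T : ℝ) ≠ 0 := by positivity
    simp only [Finset.sum_const, Nat.card_Icc, nsmul_eq_mul, Nat.add_sub_cancel]
    field_simp

theorem IsPotential.sum_expect_sub_le (hΦ : G.IsPotential Φ) (hgap : PotentialGapLE Φ Φmax)
    (ρ : PMF S) (T : ℕ) (π : ℕ → JointPolicy S Act) :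
    ∑ t ∈ Finset.Icc 1 T, ρ.expect (fun s => Φ (π (t + 1)) s - Φ (π t) s) ≤ Φmax := by
  rw [← PMF.expect_sum _ _ fun t _ => hΦ.bddFun_sub _ _]
  have e : ∀ s, ∑ t ∈ Finset.Icc 1 T, (Φ (π (t + 1)) s - Φ (π t) s) =
      Φ (π (T + 1)) s - Φ (π 1) s := fun s => by
    induction T with
    | zero => simp
    | succ T ih => rw [Finset.sum_Icc_succ_top (by omega), ih]; ring
  simp only [e]
  exact (le_abs_self _).trans (hgap _ _ ρ)

variable [∀ i, Nonempty (Act i)] [Nonempty (Fin N)] {A : ℕ}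

theorem nashRegret_le_of_sum_sqDist_le (hA : ∀ i, Fintype.card (Act i) = A)
    (hκ : G.mismatch ρ ≠ ⊤) (hT : 1 ≤ T) (hη : 0 < η)
    (hstep : ∀ t ∈ Finset.Icc 1 T, G.IsGradientStep η (π t) (π (t + 1)))
    (hηA : η * A ≤ 1 - G.γ)
    (hsum : ∑ t ∈ Finset.Icc 1 T, ∑ i, ρ.expect (sqDist (π (t + 1) i) (π t i)) ≤ 4 * η * Φmax)
    {R c : ℝ} (hR : 0 < R)
    (hRc : (1 - G.γ)⁻¹ ^ 2 * (G.mismatch ρ).toReal * Φmax / (η * T) ≤ c * R ^ 2) :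
    G.nashRegret ρ T π ≤ (4 * c + 3 / 2) * R := by
  have hκ1 := one_le_mismatch hκ (π 1)
  have hm := one_sub_γ_pos (G := G)
  have hT0 : (0 : ℝ) < T := by exact_mod_cast hT
  have hA1 : (1 : ℝ) ≤ A := by
    obtain ⟨i⟩ := ‹Nonempty (Fin N)›
    rw [← hA i]; exact_mod_cast Fintype.card_pos
  have hg0 : 0 < (1 - G.γ)⁻¹ := inv_pos.2 hm
  have hη1 : η * A * (1 - G.γ)⁻¹ ≤ 1 := by
    rw [← div_eq_mul_inv]; exact (div_le_one hm).2 hηA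
  have hηg : (A : ℝ) * (η * (1 - G.γ)⁻¹) ^ 2 ≤ 1 := by
    calc (A : ℝ) * (η * (1 - G.γ)⁻¹) ^ 2 = 1 * A * (η * (1 - G.γ)⁻¹) ^ 2 := by ring
      _ ≤ A * A * (η * (1 - G.γ)⁻¹) ^ 2 := by gcongr
      _ = (η * A * (1 - G.γ)⁻¹) ^ 2 := by ring
      _ ≤ 1 := pow_le_one₀ (by positivity) hη1
  set g := (1 - G.γ)⁻¹ with hg
  set κ := (G.mismatch ρ).toReal
  have hκ0 : 0 < κ := zero_lt_one.trans_le hκ1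
  set E : ℕ → ℝ := fun t => ∑ i, ρ.expect (sqDist (π (t + 1) i) (π t i)) with hE
  -- With AM–GM parameter g/(ηR), the constant term contributes exactly 3R/2 and the squared
  -- distances at most 4cR.
  have hl : 0 < g / (η * R) := by positivity
  have h1 := nashRegret_le (G := G) (ρ := ρ) (π := π) hT
    (fun t => g * (2 * η)⁻¹ * (2 * (g / (η * R)) * (κ * E t) + 3 / (g / (η * R))))
    fun t ht i p => by
      refine ((hstep t ht).expect_V_update_sub_le hη hκ i (by rw [hA i]; exact hηg) p hl).trans ?_
      have : ρ.expect (sqDist (π (t + 1) i) (π t i)) ≤ E t :=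
        Finset.single_le_sum
          (f := fun i => ρ.expect (sqDist (π (t + 1) i) (π t i)))
          (fun j _ => PMF.expect_nonneg _ (sqDist_nonneg _ _)) (Finset.mem_univ i)
      gcongr
  refine h1.trans ?_
  rw [← Finset.mul_sum, Finset.sum_add_distrib, ← Finset.mul_sum, ← Finset.mul_sum,
    Finset.sum_const, Nat.card_Icc, nsmul_eq_mul, Nat.add_sub_cancel]
  have h2 : 1 / (T : ℝ) * (g * (2 * η)⁻¹ * (2 * (g / (η * R)) *
      (κ * ∑ t ∈ Finset.Icc 1 T, E t) + T * (3 / (g / (η * R))))) ≤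
      1 / (T : ℝ) * (g * (2 * η)⁻¹ * (2 * (g / (η * R)) *
      (κ * (4 * η * Φmax)) + T * (3 / (g / (η * R))))) := by gcongr
  refine h2.trans ?_
  have h3 : 1 / (T : ℝ) * (g * (2 * η)⁻¹ * (2 * (g / (η * R)) *
      (κ * (4 * η * Φmax)) + T * (3 / (g / (η * R))))) =
      4 * (g ^ 2 * κ * Φmax / (η * T)) / R + 3 / 2 * R := by
    have := hg0.ne'
    field_simp
  have h4 : 4 * (g ^ 2 * κ * Φmax / (η * T)) / R ≤ 4 * c * R := by
    rw [div_le_iff₀ hR]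
    linarith
  rw [h3]
  linarith

theorem nashRegret_le_of_small_stepsize (hA : ∀ i, Fintype.card (Act i) = A)
    (hΦ : G.IsPotential Φ) (hΦmax : 0 < Φmax) (hgap : PotentialGapLE Φ Φmax)
    (hκ : G.mismatch ρ ≠ ⊤) (hT : 1 ≤ T)
    (hstep : ∀ t ∈ Finset.Icc 1 T, G.IsGradientStep η (π t) (π (t + 1)))
    (hη : η = (1 - G.γ) ^ (5 / 2 : ℝ) * √Φmax / (N * A * √T)) :
    G.nashRegret ρ T π ≤ 34 * (√((G.mismatch ρ).toReal * A * N) * Φmax ^ (1 / 4 : ℝ) /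
      ((1 - G.γ) ^ (9 / 4 : ℝ) * (T : ℝ) ^ (1 / 4 : ℝ))) := by
  have hκ1 := one_le_mismatch hκ (π 1)
  have hm := one_sub_γ_pos (G := G)
  have hm1 : 1 - G.γ ≤ 1 := by linarith [G.γ_nonneg]
  have hT0 : (0 : ℝ) < T := by exact_mod_cast hT
  have hA1 : (1 : ℝ) ≤ A := by
    obtain ⟨i⟩ := ‹Nonempty (Fin N)›
    rw [← hA i]; exact_mod_cast Fintype.card_pos
  have hN1 : (1 : ℝ) ≤ N := by
    obtain ⟨i⟩ := ‹Nonempty (Fin N)›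
    exact_mod_cast i.pos
  have hA0 : (0 : ℝ) < A := by linarith
  have hN0 : (0 : ℝ) < N := by linarith
  have hκ0 : 0 < (G.mismatch ρ).toReal := by linarith
  have hη0 : 0 < η := by rw [hη]; positivity
  set R := √((G.mismatch ρ).toReal * A * N) * Φmax ^ (1 / 4 : ℝ) /
      ((1 - G.γ) ^ (9 / 4 : ℝ) * (T : ℝ) ^ (1 / 4 : ℝ)) with hRdef
  have hR : 0 < R := by positivity
  -- If R ≥ g, the trivial bound g on the regret suffices; otherwise R < g forces η to be small
  -- enough for `hηA`.
  rcases le_or_gt (1 - G.γ)⁻¹ R with hle | hlt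
  · exact (nashRegret_le_inv hT).trans (hle.trans (by linarith))
  have hx : ((1 - G.γ) ^ (5 / 2 : ℝ)) ^ 2 = (1 - G.γ) ^ 5 := by
    rw [← Real.rpow_mul_natCast hm.le, ← Real.rpow_natCast]; norm_num
  have hx' : ((1 - G.γ) ^ (9 / 4 : ℝ)) ^ 2 = (1 - G.γ) ^ (5 / 2 : ℝ) * (1 - G.γ) ^ 2 := by
    rw [← Real.rpow_mul_natCast hm.le, ← Real.rpow_natCast, ← Real.rpow_add hm]; norm_num
  have hq : ∀ {y : ℝ}, 0 < y → (y ^ (1 / 4 : ℝ)) ^ 2 = √y := fun {y} hy => by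
    rw [← Real.rpow_mul_natCast hy.le, Real.sqrt_eq_rpow]; norm_num
  have hsΦ := Real.sq_sqrt hΦmax.le
  have hsT := Real.sq_sqrt hT0.le
  have hsΦ0 := Real.sqrt_pos.2 hΦmax
  have hsT0 := Real.sqrt_pos.2 hT0
  have hR2 : R ^ 2 = (G.mismatch ρ).toReal * A * N * √Φmax /
      ((1 - G.γ) ^ (5 / 2 : ℝ) * (1 - G.γ) ^ 2 * √T) := by
    rw [hRdef, div_pow, mul_pow, mul_pow, Real.sq_sqrt (by positivity), hq hΦmax, hq hT0, hx']
  have hy0 : 0 < (1 - G.γ) ^ (5 / 2 : ℝ) := by positivity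
  have hRη : (1 - G.γ)⁻¹ ^ 2 * (G.mismatch ρ).toReal * Φmax / (η * T) = R ^ 2 := by
    rw [hR2, hη]
    generalize (1 - G.γ) ^ (5 / 2 : ℝ) = y at hy0
    generalize (G.mismatch ρ).toReal = κ at hκ0
    rw [← hsΦ, ← hsT, Real.sqrt_sq hsΦ0.le, Real.sqrt_sq hsT0.le]
    field_simp
  -- The stepsize makes the losses of all T steps total 3 Φmax; with the rise Φmax of the potential
  -- this is the 4 in `hsum`.
  have hηΦ : (N * A * η) ^ 2 * T * (1 - G.γ)⁻¹ ^ 5 = Φmax := by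
    have : N * A * η = (1 - G.γ) ^ (5 / 2 : ℝ) * √Φmax / √T := by
      rw [hη]; field_simp
    rw [this, div_pow, mul_pow, hx, hsΦ, hsT]
    field_simp
  have hηA : η * A ≤ 1 - G.γ := by
    have h1 : R ^ 2 < (1 - G.γ)⁻¹ ^ 2 := pow_lt_pow_left₀ hlt hR.le two_ne_zero
    rw [← hRη, ← hηΦ, div_lt_iff₀ (by positivity)] at h1
    have h2 : (G.mismatch ρ).toReal * (N * A) ^ 2 * η < (1 - G.γ) ^ 5 := by
      have h3 := mul_lt_mul_of_pos_right h1 (by positivity : 0 < (1 - G.γ) ^ 7 / (η * T))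
      generalize (G.mismatch ρ).toReal = κ at hκ0 h3 ⊢
      have e1 : (1 - G.γ)⁻¹ ^ 2 * κ * ((N * A * η) ^ 2 * T * (1 - G.γ)⁻¹ ^ 5) *
          ((1 - G.γ) ^ 7 / (η * T)) = κ * (N * A) ^ 2 * η := by field_simp
      have e2 : (1 - G.γ)⁻¹ ^ 2 * (η * T) * ((1 - G.γ) ^ 7 / (η * T)) = (1 - G.γ) ^ 5 := by
        field_simp
      rwa [e1, e2] at h3
    have h4 : (1 - G.γ) ^ 5 ≤ 1 - G.γ := pow_le_of_le_one hm.le hm1 (by norm_num)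
    have h5 : (A : ℝ) ≤ (N * A) ^ 2 := by
      have : (A : ℝ) ≤ N * A := le_mul_of_one_le_left hA0.le hN1
      nlinarith
    have h6 : (A : ℝ) ≤ (G.mismatch ρ).toReal * (N * A) ^ 2 :=
      h5.trans (le_mul_of_one_le_left (by positivity) hκ1)
    have := mul_le_mul_of_nonneg_right h6 hη0.le
    linarith
  have hsum : ∑ t ∈ Finset.Icc 1 T, ∑ i, ρ.expect (sqDist (π (t + 1) i) (π t i)) ≤
      4 * η * Φmax := by
    have h1 := (Finset.sum_le_sum fun t ht =>
      hΦ.le_expect_sub_of_uniform (ρ := ρ) hA (hstep t ht) hη0).trans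
        (hΦ.sum_expect_sub_le hgap ρ T π)
    rw [Finset.sum_sub_distrib, ← Finset.mul_sum, Finset.sum_const, Nat.card_Icc, nsmul_eq_mul,
      Nat.add_sub_cancel] at h1
    have h2 : η⁻¹ * ∑ t ∈ Finset.Icc 1 T, ∑ i, ρ.expect (sqDist (π (t + 1) i) (π t i)) ≤
        4 * Φmax := by linarith
    rw [inv_mul_le_iff₀ hη0] at h2
    linarith
  have := nashRegret_le_of_sum_sqDist_le hA hκ hT hη0 hstep hηA hsum (c := 1) hR (by
    rw [hRη, one_mul])
  linarith

theorem nashRegret_le_of_mismatch_stepsize (hA : ∀ i, Fintype.card (Act i) = A)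
    (hΦ : G.IsPotential Φ) (hΦmax : 0 < Φmax) (hgap : PotentialGapLE Φ Φmax)
    (hκ : G.mismatch ρ ≠ ⊤) (hT : 1 ≤ T)
    (hstep : ∀ t ∈ Finset.Icc 1 T, G.IsGradientStep η (π t) (π (t + 1)))
    (hη : η = (1 - G.γ) ^ 4 / (8 * (G.mismatch ρ).toReal ^ 3 * N * A)) :
    G.nashRegret ρ T π ≤ 34 * ((G.mismatch ρ).toReal ^ 2 * √(A * N * Φmax) /
      ((1 - G.γ) ^ 3 * √T)) := by
  have hκ1 := one_le_mismatch hκ (π 1)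
  have hm := one_sub_γ_pos (G := G)
  have hm1 : 1 - G.γ ≤ 1 := by linarith [G.γ_nonneg]
  have hT0 : (0 : ℝ) < T := by exact_mod_cast hT
  have hA1 : (1 : ℝ) ≤ A := by
    obtain ⟨i⟩ := ‹Nonempty (Fin N)›
    rw [← hA i]; exact_mod_cast Fintype.card_pos
  have hN1 : (1 : ℝ) ≤ N := by
    obtain ⟨i⟩ := ‹Nonempty (Fin N)›
    exact_mod_cast i.pos
  have hA0 : (0 : ℝ) < A := by linarith
  have hN0 : (0 : ℝ) < N := by linarith
  have hκ0 : 0 < (G.mismatch ρ).toReal := by linarith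
  have hη0 : 0 < η := by rw [hη]; positivity
  set R := (G.mismatch ρ).toReal ^ 2 * √(A * N * Φmax) / ((1 - G.γ) ^ 3 * √T) with hRdef
  have hR : 0 < R := by positivity
  have hR2 : R ^ 2 = (G.mismatch ρ).toReal ^ 4 * (A * N * Φmax) / ((1 - G.γ) ^ 6 * T) := by
    rw [hRdef, div_pow, mul_pow, mul_pow, Real.sq_sqrt (by positivity), Real.sq_sqrt hT0.le]
    ring
  have hRη : (1 - G.γ)⁻¹ ^ 2 * (G.mismatch ρ).toReal * Φmax / (η * T) = 8 * R ^ 2 := by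
    rw [hR2, hη]
    generalize (G.mismatch ρ).toReal = κ at hκ0
    field_simp
  have hηinv : N * A * (G.mismatch ρ).toReal ^ 3 * (1 - G.γ)⁻¹ ^ 4 = η⁻¹ / 8 := by
    rw [hη]
    field_simp
  have hηA : η * A ≤ 1 - G.γ := by
    have h1 : η * A = (1 - G.γ) ^ 4 / (8 * (G.mismatch ρ).toReal ^ 3 * N) := by
      rw [hη]; field_simp
    have h2 : (1 - G.γ) ^ 4 ≤ 1 - G.γ := pow_le_of_le_one hm.le hm1 (by norm_num)
    have h3 : 1 ≤ 8 * (G.mismatch ρ).toReal ^ 3 * N := by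
      have := one_le_mul_of_one_le_of_one_le (one_le_pow₀ hκ1 (n := 3)) hN1
      linarith
    rw [h1]
    exact (div_le_self (by positivity) h3).trans h2
  have hsum : ∑ t ∈ Finset.Icc 1 T, ∑ i, ρ.expect (sqDist (π (t + 1) i) (π t i)) ≤
      4 * η * Φmax := by
    have h1 := (Finset.sum_le_sum fun t ht =>
      hΦ.le_expect_sub_of_mismatch (ρ := ρ) hA hκ (hstep t ht) hη0).trans
        (hΦ.sum_expect_sub_le hgap ρ T π)
    -- The loss takes 3/8 of the gain, leaving 5/8; the resulting factor 8/5 is below 4.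
    rw [← Finset.mul_sum, hηinv] at h1
    have h2 : η⁻¹ * ∑ t ∈ Finset.Icc 1 T, ∑ i, ρ.expect (sqDist (π (t + 1) i) (π t i)) ≤
        4 * Φmax := by linarith
    rw [inv_mul_le_iff₀ hη0] at h2
    linarith
  have := nashRegret_le_of_sum_sqDist_le hA hκ hT hη0 hstep hηA hsum (c := 8) hR hRη.le
  linarith

end MarkovGame

theorem theorem1 :
    ∃ C : ℝ, 0 < C ∧
      ∀ (N : ℕ) (S : Type*) (Act : Fin N → Type*) [∀ i, Fintype (Act i)] [∀ i, Nonempty (Act i)]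
        (A : ℕ) (G : MarkovGame N S Act) (ρ : PMF S)
        (Φ : JointPolicy S Act → S → ℝ) (Φmax : ℝ)
        (η : ℝ) (T : ℕ) (π : ℕ → JointPolicy S Act),
        2 ≤ N →
        (∀ i, Fintype.card (Act i) = A) →
        G.IsPotential Φ →
        0 < Φmax →
        MarkovGame.PotentialGapLE Φ Φmax →
        G.mismatch ρ ≠ ⊤ →
        1 ≤ T →
        G.IsPolicyGradientRun η T π →
        (η = (1 - G.γ) ^ (5 / 2 : ℝ) * √Φmax / (N * A * √T) →
          G.nashRegret ρ T π ≤
            C * (√((G.mismatch ρ).toReal * A * N) * Φmax ^ (1 / 4 : ℝ) /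
              ((1 - G.γ) ^ (9 / 4 : ℝ) * (T : ℝ) ^ (1 / 4 : ℝ)))) ∧
        (η = (1 - G.γ) ^ 4 / (8 * (G.mismatch ρ).toReal ^ 3 * N * A) →
          G.nashRegret ρ T π ≤
            C * ((G.mismatch ρ).toReal ^ 2 * √(A * N * Φmax) /
              ((1 - G.γ) ^ 3 * √T))) := by
  -- The two cases give 4·1 + 3/2 and 4·8 + 3/2, both below 34.
  refine ⟨34, by norm_num, ?_⟩
  intro N S Act _ _ A G ρ Φ Φmax η T π hN hA hΦ hΦmax hgap hκ hT hrun
  have : Nonempty (Fin N) := ⟨⟨0, by omega⟩⟩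
  exact ⟨MarkovGame.nashRegret_le_of_small_stepsize hA hΦ hΦmax hgap hκ hT hrun.2,
    MarkovGame.nashRegret_le_of_mismatch_stepsize hA hΦ hΦmax hgap hκ hT hrun.2⟩
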